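/- Let $F=F(x_1,\dots,x_k)$ be the free group of rank $k\ge 2$ with free basis $A=\{x_1,\dots,x_k\}$, and let $H\le F$ be any subgroup. Let $H_A\subseteq (A\cup A^{-1})^*$ be the set of all words (reduced or not) representing elements of $H$. Let $a_n$ (respectively $r_n$) be the number of freely reduced words of length exactly $n$ (respectively at most $n$) in $H_A$, and let $b_n$ (respectively $z_n$) be the number of all words of length exactly $n$ (respectively at most $n$) in $H_A$. Let $\Gamma$ be the Schreier coset graph of $H$: its vertices are the cosets $Hg$, $g\in F$; for each coset $Hg$ and each letter $l\in A\cup A^{-1}$ there is an oriented edge labelled $l$ from $Hg$ to $Hgl$, and its inverse is the edge labelled $l^{-1}$ from $Hgl$ to $Hg$. Let $\alpha=\limsup_n \sqrt[n]{a_n(\Gamma)}$ and $\beta=\limsup_n\sqrt[n]{b_n(\Gamma)}$, where $a_n(\Gamma)$ (respectively $b_n(\Gamma)$) is the number of edge-paths without backtracks (respectively of all edge-paths) of length $n$ in $\Gamma$ from the vertex $H1$ to itself. The graph $\Gamma$ is called amenable if its spectral radius $\nu=\beta/(2k)$ equals $1$. A sequence $s_n\ge 0$ with $s_n\to 0$ converges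 exponentially fast if there are $0\le\sigma<1$ and $C>0$ with $s_n\le C\sigma^n$ for all $n\ge 1$. Then $\Gamma$ is a $2k$-regular graph (each vertex is the origin of exactly $2k$ oriented edges), $\alpha\le 2k-1$ and $\beta\le 2k$. The ball of radius $n$ around $1$ in $F$ with respect to $A$ has exactly $1+\frac{k}{k-1}\left[(2k-1)^n-1\right]$ elements for every $n\ge 0$. Moreover: 1. If $[F:H]=\infty$ then $$\lim_{n\to\infty}\frac{a_n}{(2k-1)^n}=\lim_{n\to\infty}\frac{r_n}{(2k-1)^n}=0,\qquad \lim_{n\to\infty}\frac{b_n}{(2k)^n}=\lim_{n\to\infty}\frac{z_n}{(2k)^n}=0 .$$ Moreover $H$ has zero asymptotic density, both among words and among group elements: $$\lim_{n\to\infty}\frac{z_n}{\#\{w\in(A\cup A^{-1})^*:|w|\le n\}}=0,\qquad \lim_{n\to\infty}\frac{\#\{h\in H: |h|_A\le n\}}{\#\{g\in F: |g|_A\le n\}}=0,$$ where $|w|$ is the length of the word $w$ and $|g|_A$ is the length of the reduced word representing $g$. 2. If $\Gamma$ is non-amenable, then $[F:H]=\infty$ and all the limits in part 1 converge to zero exponentially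 fast. 3. If $[F:H]<\infty$ then $$\limsup_{n\to\infty}\frac{a_n}{(2k-1)^n}>0,\quad \limsup_{n\to\infty}\frac{r_n}{(2k-1)^n}>0,\quad \limsup_{n\to\infty}\frac{b_n}{(2k)^n}>0,\quad \limsup_{n\to\infty}\frac{z_n}{(2k)^n}>0 .$$ -/

import Mathlib

open Filter Topology
open scoped ENNReal

/-- A graph in which loops and multiple edges are allowed: every (oriented) edge `e` has an origin
`o e`, a terminus `t e` and a formal inverse edge `inv e ≠ e`. -/
structure SerreGraph (V E : Type*) where
  o : E → V
  t : E → V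
  inv : E → E
  o_inv : ∀ e, o (inv e) = t e
  t_inv : ∀ e, t (inv e) = o e
  inv_inv : ∀ e, inv (inv e) = e
  inv_ne : ∀ e, inv e ≠ e

namespace SerreGraph

variable {V E : Type*} (Γ : SerreGraph V E)

/-- Every vertex is the origin of exactly `d` oriented edges. -/
def IsRegular (d : ℕ) : Prop :=
  ∀ v : V, {e : E | Γ.o e = v}.encard = d

/-- `Γ.IsPath u p v`: the list of oriented edges `p` is an edge-path from `u` to `v`. -/
def IsPath : V → List E → V → Prop
  | u, [], v => u = v
  | u, e :: p, v => Γ.o e = u ∧ IsPath (Γ.t e) p v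

/-- A sequence of edges without backtracks: no edge is followed by its inverse. -/
def IsReduced (p : List E) : Prop :=
  p.IsChain fun e f => f ≠ Γ.inv e

/-- The number of reduced paths of length `n` from `x₀` to `x₀`. -/
noncomputable def numReducedClosedPaths (x₀ : V) (n : ℕ) : ℕ :=
  {p : List E | Γ.IsPath x₀ p x₀ ∧ Γ.IsReduced p ∧ p.length = n}.ncard

/-- The number of all paths of length `n` from `x₀` to `x₀`. -/
noncomputable def numClosedPaths (x₀ : V) (n : ℕ) : ℕ :=
  {p : List E | Γ.IsPath x₀ p x₀ ∧ p.length = n}.ncard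

/-- The cogrowth rate `α`, the limsup of the `n`-th roots of the numbers of reduced closed paths.
Taken in `[0, ∞]`, so that the limsup is always a genuine one. -/
noncomputable def cogrowthRate (x₀ : V) : ℝ≥0∞ :=
  limsup (fun n : ℕ => (Γ.numReducedClosedPaths x₀ n : ℝ≥0∞) ^ (1 / (n : ℝ))) atTop

/-- The non-reduced cogrowth rate `β`. -/
noncomputable def nonReducedCogrowthRate (x₀ : V) : ℝ≥0∞ :=
  limsup (fun n : ℕ => (Γ.numClosedPaths x₀ n : ℝ≥0∞) ^ (1 / (n : ℝ))) atTop

/-- The spectral radius `ν = β / d` of a `d`-regular graph. -/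
noncomputable def spectralRadius (d : ℕ) (x₀ : V) : ℝ≥0∞ :=
  Γ.nonReducedCogrowthRate x₀ / (d : ℝ≥0∞)

/-- Amenability of a `d`-regular graph with base-vertex `x₀`: the spectral radius is `1`. -/
def IsAmenable (d : ℕ) (x₀ : V) : Prop :=
  Γ.spectralRadius d x₀ = 1

end SerreGraph

namespace CosetGraph

variable {A : Type*}

/-- The set `{H g | g ∈ F}` of right cosets of `H` in the free group `F` on `A`. -/
abbrev Vertex (H : Subgroup (FreeGroup A)) : Type _ :=
  Quotient (QuotientGroup.rightRel H)

/-- The coset `H 1`. -/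
def base (H : Subgroup (FreeGroup A)) : Vertex H :=
  Quotient.mk'' 1

/-- Right multiplication of cosets, `(H g, h) ↦ H (g h)`. -/
def mulRight (H : Subgroup (FreeGroup A)) (v : Vertex H) (h : FreeGroup A) : Vertex H :=
  Quotient.map' (fun g => g * h)
    (fun x y hxy => by
      rw [QuotientGroup.rightRel_apply] at hxy ⊢
      simpa [mul_assoc] using hxy) v

theorem mulRight_mul (H : Subgroup (FreeGroup A)) (v : Vertex H) (g h : FreeGroup A) :
    mulRight H (mulRight H v g) h = mulRight H v (g * h) := by
  induction v using Quotient.inductionOn'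
  simp [mulRight, mul_assoc]

theorem mulRight_one (H : Subgroup (FreeGroup A)) (v : Vertex H) :
    mulRight H v 1 = v := by
  induction v using Quotient.inductionOn'
  simp [mulRight]

/-- The inverse letter. The letter `(x, true)` is `x` and the letter `(x, false)` is `x⁻¹`. -/
def invLetter (l : A × Bool) : A × Bool := (l.1, !l.2)

theorem mk_letter_mul_inv (l : A × Bool) :
    FreeGroup.mk [l] * FreeGroup.mk [invLetter l] = 1 := by
  obtain ⟨x, b⟩ := l
  have h : FreeGroup.mk [invLetter (x, b)] = (FreeGroup.mk [(x, b)])⁻¹ := by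
    simp [invLetter, FreeGroup.inv_mk, FreeGroup.invRev]
  rw [h, mul_inv_cancel]

/-- The Schreier coset graph of the subgroup `H` of the free group on `A`. Its vertices are the
cosets `H g`. For each letter `l ∈ A ∪ A⁻¹` and each coset `H g` there is an edge `(H g, l)` with
label `l` from `H g` to `H g l`, whose inverse is the edge `(H g l, l⁻¹)`. -/
def graph (H : Subgroup (FreeGroup A)) : SerreGraph (Vertex H) (Vertex H × (A × Bool)) where
  o e := e.1
  t e := mulRight H e.1 (FreeGroup.mk [e.2])
  inv e := (mulRight H e.1 (FreeGroup.mk [e.2]), invLetter e.2)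
  o_inv _ := rfl
  t_inv e := by
    rw [mulRight_mul, mk_letter_mul_inv, mulRight_one]
  inv_inv e := by
    refine Prod.ext ?_ ?_
    · change mulRight H (mulRight H e.1 _) _ = e.1
      rw [mulRight_mul, mk_letter_mul_inv, mulRight_one]
    · simp [invLetter]
  inv_ne e h := by
    have h2 := congrArg (fun e => e.2.2) h
    simp [invLetter] at h2

end CosetGraph

section Words

variable {A : Type*}

/-- The set `H_A` of all words in `A ∪ A⁻¹` representing elements of `H`. -/
def wordsRepresenting (H : Subgroup (FreeGroup A)) : Set (List (A × Bool)) :=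
  {w | FreeGroup.mk w ∈ H}

/-- `a_n`: the number of freely reduced words of length `n` representing elements of `H`. -/
noncomputable def numReducedWords (H : Subgroup (FreeGroup A)) (n : ℕ) : ℕ :=
  {w : List (A × Bool) |
    w ∈ wordsRepresenting H ∧ FreeGroup.IsReduced w ∧ w.length = n}.ncard

/-- `r_n`: the number of freely reduced words of length `≤ n` representing elements of `H`. -/
noncomputable def numReducedWordsLE (H : Subgroup (FreeGroup A)) (n : ℕ) : ℕ :=
  {w : List (A × Bool) |
    w ∈ wordsRepresenting H ∧ FreeGroup.IsReduced w ∧ w.length ≤ n}.ncard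

/-- `b_n`: the number of all words of length `n` representing elements of `H`. -/
noncomputable def numWords (H : Subgroup (FreeGroup A)) (n : ℕ) : ℕ :=
  {w : List (A × Bool) | w ∈ wordsRepresenting H ∧ w.length = n}.ncard

/-- `z_n`: the number of all words of length `≤ n` representing elements of `H`. -/
noncomputable def numWordsLE (H : Subgroup (FreeGroup A)) (n : ℕ) : ℕ :=
  {w : List (A × Bool) | w ∈ wordsRepresenting H ∧ w.length ≤ n}.ncard

end Words

/-- `ρ_n(S)`: the proportion of the words of length at most `n` over the finite alphabet `X` that
lie in `S`. -/
noncomputable def wordDensity {X : Type*} (S : Set (List X)) (n : ℕ) : ℝ :=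
  ((S ∩ {w | w.length ≤ n}).ncard : ℝ) / ({w : List X | w.length ≤ n}.ncard : ℝ)

/-- The `n`-ball around the identity in the Cayley graph of a free group with respect to its free
basis, that is, the set of the elements whose reduced word has length at most `n`. -/
def freeBall (A : Type*) [DecidableEq A] (n : ℕ) : Set (FreeGroup A) :=
  {g | g.norm ≤ n}

/-- The proportion of the elements of the `n`-ball of a free group (of finite rank) that lie in
`S`. -/
noncomputable def ballDensity {A : Type*} [DecidableEq A] (S : Set (FreeGroup A)) (n : ℕ) : ℝ :=
  ((S ∩ freeBall A n).ncard : ℝ) / ((freeBall A n).ncard : ℝ)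

/-- The nonnegative sequence `s` converges to zero exponentially fast. -/
def TendsToZeroExpFast (s : ℕ → ℝ) : Prop :=
  (∀ n, 0 ≤ s n) ∧ Tendsto s atTop (𝓝 0) ∧
    ∃ σ C : ℝ, 0 ≤ σ ∧ σ < 1 ∧ 0 < C ∧ ∀ n : ℕ, 1 ≤ n → s n ≤ C * σ ^ n

/-!
Closed paths in the coset graph are counted by walks on its oriented edges. Let `u n` be the
`n`-fold average of the indicator function of the edges that end at `H1`, each average being taken
over the permitted continuations of an edge: all of them for `b_n`, all but the backtrack for `a_n`.
Up to normalization, the sum of `u n` over the edges that start at `H1` is the number of closed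
paths of length `n + 1`. Every edge is also a permitted continuation of equally many edges, so
averaging preserves the total `∑ u n = 2k` and can only decrease the energy `∑ (u n) ^ 2`. The
energy lost at time `n` controls the variation of `u n` along every permitted continuation, so this
variation tends to zero. The graph is connected and its degree exceeds two, so `u n + u (n + 1)`
becomes constant asymptotically, with total `4k`: its limit is zero if there are infinitely many
edges, and positive otherwise.

Non-amenability means that `b_n ≤ C r ^ n` for some `r < 2k`. To pass from `b_n` to `a_n`, consider
the function `g ↦ ρ ^ |g|`, which satisfies the eigenvalue equation of the Cayley graph of `F` away
from `1`, with eigenvalue `ev ρ = (2k - 1) ρ + ρ⁻¹`. It is therefore dominated by the Green function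
`∑ m, (number of words of length m for g) / ev ρ ^ m`, and summing over the elements of `H` of
length `n` gives `a_n ρ ^ n ≤ ∑ m, b_m / ev ρ ^ m`. Since `ev (2k - 1)⁻¹ = 2k`, the right-hand side
is finite for some `ρ > (2k - 1)⁻¹`.
-/

section Sequences

theorem limsup_root_le {u : ℕ → ℕ} {C c : ℕ} (hC : C ≠ 0) (hu : ∀ n, u n ≤ C * c ^ n) :
    limsup (fun n : ℕ => (u n : ℝ≥0∞) ^ (1 / (n : ℝ))) atTop ≤ c := by
  have hroot : Tendsto (fun n : ℕ => (C : ℝ≥0∞) ^ (1 / (n : ℝ)) * c) atTop (𝓝 c) := by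
    have hreal : Tendsto (fun n : ℕ => (C : ℝ) ^ (1 / (n : ℝ))) atTop (𝓝 (C ^ (0 : ℝ))) :=
      (Real.continuous_const_rpow (Nat.cast_ne_zero.2 hC)).continuousAt.tendsto.comp
        tendsto_one_div_atTop_nhds_zero_nat
    have hC' : (0 : ℝ) < C := by positivity
    simpa [← ENNReal.ofReal_rpow_of_pos hC'] using
      ENNReal.Tendsto.mul_const (ENNReal.tendsto_ofReal hreal) (Or.inr (ENNReal.natCast_ne_top c))
  rw [← hroot.limsup_eq]
  refine limsup_le_limsup ?_
  filter_upwards [eventually_ne_atTop 0] with n hn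
  calc (u n : ℝ≥0∞) ^ (1 / (n : ℝ)) ≤ (C * c ^ n) ^ (1 / (n : ℝ)) := by
        gcongr
        exact_mod_cast hu n
    _ = C ^ (1 / (n : ℝ)) * c := by
        rw [ENNReal.mul_rpow_of_nonneg _ _ (by positivity), one_div,
          ENNReal.pow_rpow_inv_natCast hn]

theorem limsup_div_pow_pos {u v : ℕ → ℕ} {q C : ℝ} (hq : 0 < q) (huv : ∀ n, u n ≤ v n)
    (hv : ∀ n, (v n : ℝ) ≤ C * q ^ n) (h : ¬ Tendsto (fun n => u n / q ^ n) atTop (𝓝 0)) :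
    0 < limsup (fun n => v n / q ^ n) atTop := by
  have hbdd : IsBoundedUnder (· ≤ ·) atTop fun n => v n / q ^ n :=
    isBoundedUnder_of ⟨C, fun n => (div_le_iff₀ (by positivity)).2 (hv n)⟩
  by_contra! hle
  refine h (tendsto_order.2 ⟨fun b hb => .of_forall fun n => hb.trans_le (by positivity),
    fun b hb => (eventually_lt_of_limsup_lt (hle.trans_lt hb) hbdd).mono fun n hn => ?_⟩)
  exact hn.trans_le' (by gcongr; exact huv n)

theorem TendsToZeroExpFast.mono {s t : ℕ → ℝ} (hs : TendsToZeroExpFast s) (ht : ∀ n, 0 ≤ t n)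
    (hts : ∀ n, t n ≤ s n) : TendsToZeroExpFast t := by
  obtain ⟨-, hlim, σ, C, hσ0, hσ1, hC, hbound⟩ := hs
  exact ⟨ht, squeeze_zero ht hts hlim, σ, C, hσ0, hσ1, hC, fun n hn => (hts n).trans (hbound n hn)⟩

theorem sum_range_le_of_le_mul_pow {u : ℕ → ℕ} {C r : ℝ} (hr : 1 < r)
    (hu : ∀ n, (u n : ℝ) ≤ C * r ^ n) (n : ℕ) :
    ((∑ i ∈ Finset.range (n + 1), u i : ℕ) : ℝ) ≤ C * (r / (r - 1)) * r ^ n := by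
  have hC : 0 ≤ C := by simpa using (Nat.cast_nonneg (u 0)).trans (hu 0)
  have : 0 < r - 1 := sub_pos.2 hr
  calc ((∑ i ∈ Finset.range (n + 1), u i : ℕ) : ℝ) ≤ ∑ i ∈ Finset.range (n + 1), C * r ^ i := by
        rw [Nat.cast_sum]
        exact Finset.sum_le_sum fun i _ => hu i
    _ = C * ((r ^ (n + 1) - 1) / (r - 1)) := by rw [← Finset.mul_sum, geom_sum_eq hr.ne']
    _ ≤ C * (r ^ (n + 1) / (r - 1)) := by gcongr; linarith
    _ = C * (r / (r - 1)) * r ^ n := by ring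

theorem tendsto_sum_range_div_pow {u : ℕ → ℕ} {q : ℝ} (hq : 1 < q)
    (h : Tendsto (fun n => u n / q ^ n) atTop (𝓝 0)) :
    Tendsto (fun n => ((∑ i ∈ Finset.range (n + 1), u i : ℕ) : ℝ) / q ^ n) atTop (𝓝 0) := by
  have hu : (fun n => (u n : ℝ)) =o[atTop] (q ^ · : ℕ → ℝ) :=
    (Asymptotics.isLittleO_iff_tendsto fun n hn => absurd hn (by positivity)).2 h
  have hdiv : Tendsto (fun n => ∑ i ∈ Finset.range n, q ^ i) atTop atTop := by
    rw [← not_summable_iff_tendsto_nat_atTop_of_nonneg fun n => by positivity,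
      summable_geometric_iff_norm_lt_one, Real.norm_of_nonneg (by positivity), not_lt]
    exact hq.le
  have hgeom : (fun n => ∑ i ∈ Finset.range (n + 1), q ^ i) =O[atTop] (q ^ · : ℕ → ℝ) := by
    refine .of_bound (q / (q - 1)) (.of_forall fun n => ?_)
    have : 0 < q - 1 := sub_pos.2 hq
    rw [Real.norm_of_nonneg (by positivity), Real.norm_of_nonneg (by positivity),
      geom_sum_eq hq.ne', div_mul_eq_mul_div, ← pow_succ']
    gcongr
    linarith
  have hsum := ((hu.sum_range (fun n => by positivity) hdiv).comp_tendsto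
    (tendsto_add_atTop_nat 1)).trans_isBigO hgeom
  simpa using hsum.tendsto_div_nhds_zero

/-- The growth of `u` is exponentially smaller than that of the powers of `q`: the sequence `u` is
bounded by a geometric one with ratio in `(1, q)`. -/
def GrowsSlowerThan (u : ℕ → ℕ) (q : ℝ) : Prop :=
  ∃ r ∈ Set.Ioo 1 q, ∃ C, ∀ n, (u n : ℝ) ≤ C * r ^ n

namespace GrowsSlowerThan

variable {u : ℕ → ℕ} {q : ℝ}

theorem of_limsup_root_lt {q : ℕ} (hq : 1 < q)
    (h : limsup (fun n : ℕ => (u n : ℝ≥0∞) ^ (1 / (n : ℝ))) atTop < q) : GrowsSlowerThan u q := by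
  obtain ⟨r, hr, hrq⟩ := ENNReal.lt_iff_exists_nnreal_btwn.1
    (max_lt h (Nat.one_lt_cast.2 hq : (1 : ℝ≥0∞) < q))
  rw [max_lt_iff] at hr
  have hr1 : 1 < (r : ℝ) := by exact_mod_cast hr.2
  have hpow : ∀ᶠ n in atTop, (u n : ℝ) ≤ r ^ n := by
    filter_upwards [eventually_lt_of_limsup_lt hr.1, eventually_gt_atTop 0] with n hn hn0
    rw [one_div] at hn
    have hle := (ENNReal.rpow_inv_le_iff (Nat.cast_pos.2 hn0)).1 hn.le
    rw [ENNReal.rpow_natCast] at hle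
    exact_mod_cast hle
  have hbigO : (fun n => (u n : ℝ)) =O[atTop] ((r : ℝ) ^ · : ℕ → ℝ) :=
    .of_bound 1 <| hpow.mono fun n hn => by simpa using hn
  obtain ⟨C, -, hC⟩ := Asymptotics.bound_of_isBigO_nat_atTop hbigO
  refine ⟨r, ⟨hr1, by exact_mod_cast hrq⟩, C, fun n => ?_⟩
  simpa using hC (x := n) (by positivity)

theorem sum_range (h : GrowsSlowerThan u q) :
    GrowsSlowerThan (fun n => ∑ i ∈ Finset.range (n + 1), u i) q := by
  obtain ⟨r, hr, C, hC⟩ := h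
  exact ⟨r, hr, C * (r / (r - 1)), sum_range_le_of_le_mul_pow hr.1 hC⟩

theorem tendsToZeroExpFast (h : GrowsSlowerThan u q) :
    TendsToZeroExpFast fun n => u n / q ^ n := by
  obtain ⟨r, ⟨hr1, hrq⟩, C, hC⟩ := h
  have hq : 0 < q := by linarith
  have hσ : r / q < 1 := (div_lt_one hq).2 hrq
  have hnonneg (n : ℕ) : 0 ≤ (u n : ℝ) / q ^ n := by positivity
  have hC0 : 0 ≤ C := by simpa using (Nat.cast_nonneg (u 0)).trans (hC 0)
  have hbound (n : ℕ) : (u n : ℝ) / q ^ n ≤ (C + 1) * (r / q) ^ n := by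
    rw [div_pow, ← mul_div_assoc]
    gcongr
    exact (hC n).trans (by gcongr; linarith)
  have hlim : Tendsto (fun n => (C + 1) * (r / q) ^ n) atTop (𝓝 0) := by
    simpa using (tendsto_pow_atTop_nhds_zero_of_lt_one (by positivity) hσ).const_mul (C + 1)
  exact ⟨hnonneg, squeeze_zero hnonneg hbound hlim, r / q, C + 1, by positivity, hσ,
    by positivity, fun n _ => hbound n⟩

end GrowsSlowerThan

end Sequences

/-! ### Averaging on regular digraphs -/

/-- A directed graph on `X`, given by its successor and predecessor sets, in which every vertex has
exactly `c` successors and exactly `c` predecessors. The walks studied below are the walks of such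
graphs on the oriented edges of a `SerreGraph`. -/
structure RegularDigraph (X : Type*) (c : ℕ) where
  succ : X → Finset X
  pred : X → Finset X
  mem_pred : ∀ {x y}, x ∈ pred y ↔ y ∈ succ x
  card_succ : ∀ x, (succ x).card = c
  card_pred : ∀ y, (pred y).card = c

namespace RegularDigraph

variable {X : Type*} {c : ℕ} (D : RegularDigraph X c)

/-- The averaging operator: `D.mean f x` is the mean of `f` over the successors of `x`. -/
noncomputable def mean (f : X → ℝ) (x : X) : ℝ :=
  (∑ y ∈ D.succ x, f y) / c

theorem sum_succ (hc : 0 < c) (f : X → ℝ) (x : X) : ∑ y ∈ D.succ x, f y = c * D.mean f x := by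
  rw [mean, mul_div_cancel₀ _ (by positivity)]

theorem mean_nonneg {f : X → ℝ} (hf : 0 ≤ f) : 0 ≤ D.mean f := fun _ =>
  div_nonneg (Finset.sum_nonneg fun y _ => hf y) c.cast_nonneg

theorem iterate_mean_nonneg {f : X → ℝ} (hf : 0 ≤ f) (n : ℕ) : 0 ≤ D.mean^[n] f :=
  Function.Iterate.rec _ hf (fun _ => D.mean_nonneg) n

theorem mean_le_one {f : X → ℝ} (hf : f ≤ 1) : D.mean f ≤ 1 := fun _ => by
  refine div_le_one_of_le₀ ((Finset.sum_le_sum fun y _ => hf y).trans ?_) c.cast_nonneg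
  simp [D.card_succ]

theorem iterate_mean_le_one {f : X → ℝ} (hf : f ≤ 1) (n : ℕ) : D.mean^[n] f ≤ 1 :=
  Function.Iterate.rec _ hf (fun _ => D.mean_le_one) n

/-- Double counting of the arrows `x → y`: every `y` has exactly `c` predecessors. -/
theorem hasSum_mean (hc : 0 < c) {f : X → ℝ} (hf : 0 ≤ f) {a : ℝ} (h : HasSum f a) :
    HasSum (D.mean f) a := by
  classical
  have hc' : (c : ℝ) ≠ 0 := by positivity
  let g : X × X → ℝ := fun p => if p.1 ∈ D.succ p.2 then f p.1 else 0
  have hg : 0 ≤ g := fun p => by dsimp only [g]; split_ifs; exacts [hf _, le_rfl]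
  have hcol (y : X) : HasSum (fun x => g (y, x)) (c * f y) := by
    have := hasSum_sum_of_ne_finset_zero (f := fun x => g (y, x)) (s := D.pred y)
      (L := .unconditional X) fun x hx => if_neg (mt D.mem_pred.2 hx)
    rwa [Finset.sum_congr rfl fun x hx => if_pos (D.mem_pred.1 hx),
      Finset.sum_const (f y), D.card_pred, nsmul_eq_mul] at this
  have hrow (x : X) : HasSum (fun y => g (y, x)) (c * D.mean f x) := by
    have := hasSum_sum_of_ne_finset_zero (f := fun y => g (y, x)) (s := D.succ x)
      (L := .unconditional X) fun y hy => if_neg hy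
    rwa [Finset.sum_congr rfl fun y hy => if_pos hy, D.sum_succ hc] at this
  have hsum : Summable g := (summable_prod_of_nonneg hg).2
    ⟨fun y => (hcol y).summable, by simpa only [(hcol _).tsum_eq] using h.summable.mul_left _⟩
  have htotal : HasSum g (c * a) := by
    rw [← (hsum.hasSum.prod_fiberwise hcol).unique (h.mul_left _)]
    exact hsum.hasSum
  have := (((Equiv.prodComm X X).hasSum_iff.2 htotal).prod_fiberwise hrow).div_const (c : ℝ)
  simpa [hc'] using this

theorem hasSum_iterate_mean (hc : 0 < c) {f : X → ℝ} (hf : 0 ≤ f) {a : ℝ} (h : HasSum f a)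
    (n : ℕ) : HasSum (D.mean^[n] f) a := by
  induction n with
  | zero => exact h
  | succ n ih =>
    rw [Function.iterate_succ_apply']
    exact D.hasSum_mean hc (D.iterate_mean_nonneg hf n) ih

theorem sum_sq_sub_mean (hc : 0 < c) (f : X → ℝ) (x : X) :
    ∑ y ∈ D.succ x, (f y - D.mean f x) ^ 2 = c * (D.mean (f ^ 2) x - D.mean f x ^ 2) := by
  have h1 := D.sum_succ hc f x
  have h2 : ∑ y ∈ D.succ x, f y ^ 2 = c * D.mean (f ^ 2) x := D.sum_succ hc _ x
  simp only [sub_sq, Finset.sum_add_distrib, Finset.sum_sub_distrib, ← Finset.sum_mul,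
    ← Finset.mul_sum, Finset.sum_const, D.card_succ, nsmul_eq_mul, h1, h2]
  ring

theorem sq_sub_mean_le (hc : 0 < c) (f : X → ℝ) {x y : X} (hy : y ∈ D.succ x) :
    (f y - D.mean f x) ^ 2 ≤ c * (D.mean (f ^ 2) x - D.mean f x ^ 2) := by
  rw [← D.sum_sq_sub_mean hc]
  exact Finset.single_le_sum (f := fun y => (f y - D.mean f x) ^ 2) (fun _ _ => sq_nonneg _) hy

theorem sq_mean_le (hc : 0 < c) (f : X → ℝ) : D.mean f ^ 2 ≤ D.mean (f ^ 2) := fun x => by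
  have h : 0 ≤ c * (D.mean (f ^ 2) x - D.mean f x ^ 2) :=
    D.sum_sq_sub_mean hc f x ▸ Finset.sum_nonneg fun _ _ => sq_nonneg _
  exact sub_nonneg.1 (nonneg_of_mul_nonneg_right h (by positivity))

theorem summable_sq_mean (hc : 0 < c) {f : X → ℝ} (hf : Summable (f ^ 2)) :
    Summable (D.mean f ^ 2) :=
  .of_nonneg_of_le (fun _ => sq_nonneg _) (D.sq_mean_le hc f)
    (D.hasSum_mean hc (fun _ => sq_nonneg _) hf.hasSum).summable

/-- The energy `∑ f ^ 2` lost by averaging controls the variation of `f` along each arrow. -/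
theorem sq_sub_mean_le_energy (hc : 0 < c) {f : X → ℝ} (hf : Summable (f ^ 2)) {x y : X}
    (hy : y ∈ D.succ x) :
    (f y - D.mean f x) ^ 2 ≤ c * (∑' z, (f ^ 2) z - ∑' z, (D.mean f ^ 2) z) := by
  have h := (D.hasSum_mean hc (fun _ => sq_nonneg _) hf.hasSum).sub
    (D.summable_sq_mean hc hf).hasSum
  exact (D.sq_sub_mean_le hc f hy).trans <| mul_le_mul_of_nonneg_left
    (le_hasSum h x fun z _ => sub_nonneg.2 (D.sq_mean_le hc f z)) c.cast_nonneg

theorem tendsto_iterate_mean_sub (hc : 0 < c) {f : X → ℝ} (hf : Summable (f ^ 2)) {x y : X}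
    (hy : y ∈ D.succ x) :
    Tendsto (fun n => D.mean^[n] f y - D.mean^[n + 1] f x) atTop (𝓝 0) := by
  have hsum (n : ℕ) : Summable ((D.mean^[n] f) ^ 2) :=
    Function.Iterate.rec (fun g : X → ℝ => Summable (g ^ 2)) hf
      (fun _ => D.summable_sq_mean hc) n
  let energy (n : ℕ) : ℝ := ∑' z, ((D.mean^[n] f) ^ 2) z
  have hle (n : ℕ) :
      (D.mean^[n] f y - D.mean^[n + 1] f x) ^ 2 ≤ c * (energy n - energy (n + 1)) := by
    simp only [energy, Function.iterate_succ_apply']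
    exact D.sq_sub_mean_le_energy hc (hsum n) hy
  have hanti : Antitone energy := antitone_nat_of_succ_le fun n =>
    sub_nonneg.1 (nonneg_of_mul_nonneg_right ((sq_nonneg _).trans (hle n)) (by positivity))
  have henergy := tendsto_atTop_ciInf hanti
    ⟨0, Set.forall_mem_range.2 fun n => tsum_nonneg fun _ => sq_nonneg _⟩
  have hdiff : Tendsto (fun n => c * (energy n - energy (n + 1))) atTop (𝓝 0) := by
    simpa using (henergy.sub (henergy.comp (tendsto_add_atTop_nat 1))).const_mul (c : ℝ)
  exact squeeze_zero_norm (fun n => Real.abs_le_sqrt (hle n)) (by simpa using hdiff.sqrt)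

end RegularDigraph

/-- If `X` is infinite then `Nat.card X = 0`, and the limit `M / 0 = 0` is the correct one. -/
theorem tendsto_total_div_card {X : Type*} {u : ℕ → X → ℝ} {M : ℝ} (hu : ∀ n, 0 ≤ u n)
    (hM : ∀ n, HasSum (u n) M)
    (hsub : ∀ x y, Tendsto (fun n => u n x - u n y) atTop (𝓝 0)) (x : X) :
    Tendsto (fun n => u n x) atTop (𝓝 (M / Nat.card X)) := by
  have hfinset (s : Finset X) :
      Tendsto (fun n => s.card * u n x - ∑ y ∈ s, u n y) atTop (𝓝 0) := by
    simpa [Finset.sum_sub_distrib] using tendsto_finsetSum s fun y _ => hsub x y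
  cases finite_or_infinite X with
  | inl hX =>
    have := Fintype.ofFinite X
    have := Nonempty.intro x
    have hcard : (Fintype.card X : ℝ) ≠ 0 := by positivity
    have := ((hfinset Finset.univ).add_const M).div_const (Fintype.card X : ℝ)
    simpa [(hasSum_fintype (u _)).unique (hM _), hcard] using this
  | inr hX =>
    rw [Nat.card_eq_zero_of_infinite, Nat.cast_zero, div_zero]
    refine tendsto_order.2 ⟨fun a ha => .of_forall fun n => ?_, fun ε hε => ?_⟩
    · exact ha.trans_le (hu n x)
    obtain ⟨m, hm⟩ := exists_nat_gt (M / ε)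
    obtain ⟨s, rfl⟩ := Infinite.exists_subset_card_eq X m
    have hlt : 0 + M < s.card * ε := by simpa using (div_lt_iff₀ hε).1 hm
    filter_upwards [((hfinset s).add_const M).eventually_lt_const hlt] with n hn
    have := sum_le_hasSum s (fun y _ => hu n y) (hM n)
    exact lt_of_mul_lt_mul_left (by linarith) s.card.cast_nonneg

/-! ### Walks in regular graphs -/

section ListCount

variable {L : Type*} (s : Finset L) {P : List L → Prop} {n : ℕ}

theorem setOf_length_eq_succ (hs : ∀ x w, P (x :: w) → x ∈ s) :
    {w | P w ∧ w.length = n + 1} = ⋃ x ∈ s, (x :: ·) '' {w | P (x :: w) ∧ w.length = n} := by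
  ext w
  cases w with
  | nil => simp
  | cons x w =>
    simp only [Set.mem_ofPred_eq, List.length_cons, add_left_inj, Set.mem_iUnion, Set.mem_image,
      List.cons.injEq, exists_prop]
    exact ⟨fun h => ⟨x, hs x w h.1, w, h, rfl, rfl⟩, by rintro ⟨_, _, _, h, rfl, rfl⟩; exact h⟩

theorem finite_length_eq_succ (hs : ∀ x w, P (x :: w) → x ∈ s)
    (hfin : ∀ x ∈ s, {w | P (x :: w) ∧ w.length = n}.Finite) :
    {w | P w ∧ w.length = n + 1}.Finite := by
  rw [setOf_length_eq_succ s hs]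
  exact s.finite_toSet.biUnion fun x hx => (hfin x hx).image _

theorem ncard_length_eq_succ (hs : ∀ x w, P (x :: w) → x ∈ s)
    (hfin : ∀ x ∈ s, {w | P (x :: w) ∧ w.length = n}.Finite) :
    {w | P w ∧ w.length = n + 1}.ncard = ∑ x ∈ s, {w | P (x :: w) ∧ w.length = n}.ncard := by
  rw [setOf_length_eq_succ s hs]
  have hdisj : (s : Set L).PairwiseDisjoint fun x =>
      (x :: ·) '' {w | P (x :: w) ∧ w.length = n} := by
    rintro x - y - hxy
    rw [Function.onFun, Set.disjoint_left]
    rintro _ ⟨w, -, rfl⟩ ⟨w', -, h⟩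
    exact hxy (List.cons.inj h).1.symm
  exact (s.finite_toSet.ncard_biUnion (fun x hx => (hfin x hx).image _) hdisj).trans <|
    (finsum_mem_coe_finset _ s).trans <| Finset.sum_congr rfl fun x _ =>
      Set.ncard_image_of_injective _ List.cons_injective

theorem ncard_length_le [Finite L] :
    {w | P w ∧ w.length ≤ n}.ncard =
      ∑ i ∈ Finset.range (n + 1), {w | P w ∧ w.length = i}.ncard := by
  have hunion : {w | P w ∧ w.length ≤ n} =
      ⋃ i ∈ Finset.range (n + 1), {w | P w ∧ w.length = i} := by
    ext w
    simp [and_comm]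
  have hdisj : (Finset.range (n + 1) : Set ℕ).PairwiseDisjoint fun i =>
      {w | P w ∧ w.length = i} := fun i _ j _ hij =>
    Set.disjoint_left.2 fun w hi hj => hij (hi.2.symm.trans hj.2)
  rw [hunion]
  exact ((Finset.finite_toSet _).ncard_biUnion
    (fun i _ => (List.finite_length_eq L i).subset fun _ h => h.2) hdisj).trans
    (finsum_mem_coe_finset _ _)

end ListCount

namespace RegularDigraph

theorem finite_walks {X : Type*} {c : ℕ} (D : RegularDigraph X c) (x : X) (n : ℕ) :
    {p | (x :: p).IsChain (fun a b => b ∈ D.succ a) ∧ p.length = n}.Finite := by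
  induction n generalizing x with
  | zero => exact (Set.finite_singleton []).subset fun p hp => List.eq_nil_of_length_eq_zero hp.2
  | succ n ih =>
    refine finite_length_eq_succ (D.succ x) (fun y w h => ?_) fun y _ => (ih y).subset ?_
    · exact (List.isChain_cons_cons.1 h).1
    · exact fun w h => ⟨(List.isChain_cons_cons.1 h.1).2, h.2⟩

end RegularDigraph

namespace SerreGraph

variable {V E : Type*} {Γ : SerreGraph V E} {d c : ℕ}

theorem inv_injective : Function.Injective Γ.inv := Function.LeftInverse.injective Γ.inv_inv

variable (Γ) in
/-- Any two vertices are joined by an edge-path. -/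
def IsConnected : Prop :=
  ∀ u v : V, ∃ p, Γ.IsPath u p v

variable (Γ) in
/-- A rule for walking in `Γ`: a digraph on the oriented edges whose arrows `e → f` are
the permitted pairs of consecutive edges. Only backtracks may be prohibited, and every edge has the
same number `c` of permitted continuations. -/
structure WalkRule (c : ℕ) extends RegularDigraph E c where
  o_eq_of_mem_succ : ∀ {e f}, f ∈ succ e → Γ.o f = Γ.t e
  mem_succ_of_ne_inv : ∀ {e f}, Γ.o f = Γ.t e → f ≠ Γ.inv e → f ∈ succ e

namespace IsRegular

variable (h : Γ.IsRegular d)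

/-- The edges with origin `v`, as a finset. -/
noncomputable def star (v : V) : Finset E :=
  (Set.finite_of_encard_eq_coe (h v)).toFinset

theorem mem_star {v : V} {e : E} : e ∈ h.star v ↔ Γ.o e = v := by simp [star]

theorem card_star (v : V) : (h.star v).card = d := by
  rw [star, ← Set.ncard_eq_toFinset_card _ (Set.finite_of_encard_eq_coe (h v)), Set.ncard, h v,
    ENat.toNat_natCast]

/-- The walk rule without prohibitions. -/
noncomputable def walkRule : Γ.WalkRule d where
  succ e := h.star (Γ.t e)
  pred f := (h.star (Γ.o f)).map ⟨Γ.inv, inv_injective⟩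
  mem_pred {e f} := by
    simp only [Finset.mem_map, mem_star, Function.Embedding.coeFn_mk]
    constructor
    · rintro ⟨g, hg, rfl⟩
      rw [Γ.t_inv, hg]
    · exact fun he => ⟨Γ.inv e, by rw [Γ.o_inv, he], Γ.inv_inv e⟩
  card_succ e := h.card_star _
  card_pred f := by rw [Finset.card_map, h.card_star]
  o_eq_of_mem_succ := h.mem_star.1
  mem_succ_of_ne_inv hf _ := h.mem_star.2 hf

open Classical in
/-- The walk rule prohibiting all backtracks. -/
noncomputable def reducedWalkRule : Γ.WalkRule (d - 1) where
  succ e := (h.star (Γ.t e)).erase (Γ.inv e)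
  pred f := ((h.star (Γ.o f)).erase f).map ⟨Γ.inv, inv_injective⟩
  mem_pred {e f} := by
    simp only [Finset.mem_map, Finset.mem_erase, mem_star, Function.Embedding.coeFn_mk]
    constructor
    · rintro ⟨g, ⟨hne, hg⟩, rfl⟩
      exact ⟨by rwa [Γ.inv_inv, ne_comm], by rw [Γ.t_inv, hg]⟩
    · rintro ⟨hne, hf⟩
      exact ⟨Γ.inv e, ⟨hne.symm, by rw [Γ.o_inv, hf]⟩, Γ.inv_inv e⟩
  card_succ e := by rw [Finset.card_erase_of_mem (h.mem_star.2 (Γ.o_inv e)), h.card_star]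
  card_pred f := by
    rw [Finset.card_map, Finset.card_erase_of_mem (h.mem_star.2 rfl), h.card_star]
  o_eq_of_mem_succ hf := h.mem_star.1 (Finset.mem_of_mem_erase hf)
  mem_succ_of_ne_inv hf hne := Finset.mem_erase.2 ⟨hne, h.mem_star.2 hf⟩

end IsRegular

namespace WalkRule

section Count

variable (R : Γ.WalkRule c)

/-- The number of closed edge-paths at `x₀` of length `n` that obey the rule `R`. -/
noncomputable def numClosed (x₀ : V) (n : ℕ) : ℕ :=
  {p | (Γ.IsPath x₀ p x₀ ∧ p.IsChain fun e f => f ∈ R.succ e) ∧ p.length = n}.ncard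

variable (Γ) in
/-- The indicator function of the edges that end at `x₀`. -/
noncomputable def endsAt (x₀ : V) : E → ℝ :=
  {e | Γ.t e = x₀}.indicator 1

theorem endsAt_nonneg (x₀ : V) : 0 ≤ endsAt Γ x₀ :=
  Set.indicator_nonneg fun _ _ => zero_le_one

theorem endsAt_le_one (x₀ : V) : endsAt Γ x₀ ≤ 1 :=
  Set.indicator_le_self' fun _ _ => zero_le_one

theorem hasSum_endsAt (h : Γ.IsRegular d) (x₀ : V) : HasSum (endsAt Γ x₀) d := by
  classical
  have hinv : endsAt Γ x₀ ∘ Γ.inv = (h.star x₀ : Set E).indicator 1 := by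
    ext e
    simp [endsAt, Set.indicator_apply, Γ.t_inv, h.mem_star]
  let σ : Equiv.Perm E := ⟨Γ.inv, Γ.inv, Γ.inv_inv, Γ.inv_inv⟩
  refine σ.hasSum_iff.1 ?_
  rw [show endsAt Γ x₀ ∘ σ = _ from hinv]
  exact hasSum_subtype_iff_indicator.1 (by simpa [h.card_star] using (h.star x₀).hasSum (1 : E → ℝ))

theorem ncard_walks (hc : 0 < c) (x₀ : V) (n : ℕ) (e : E) :
    ({p | (Γ.IsPath (Γ.t e) p x₀ ∧ (e :: p).IsChain fun e f => f ∈ R.succ e) ∧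
      p.length = n}.ncard : ℝ) = c ^ n * R.mean^[n] (endsAt Γ x₀) e := by
  induction n generalizing e with
  | zero =>
    have hnil : {p | (Γ.IsPath (Γ.t e) p x₀ ∧ (e :: p).IsChain fun e f => f ∈ R.succ e) ∧
        p.length = 0} = {p | p = [] ∧ Γ.t e = x₀} := by
      ext p
      cases p <;> simp [IsPath]
    rw [hnil]
    by_cases he : Γ.t e = x₀ <;> simp [endsAt, he]
  | succ n ih =>
    have hcons (f : E) (p : List E) : (Γ.IsPath (Γ.t e) (f :: p) x₀ ∧
        (e :: f :: p).IsChain fun e f => f ∈ R.succ e) ↔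
        f ∈ R.succ e ∧ Γ.IsPath (Γ.t f) p x₀ ∧ (f :: p).IsChain fun e f => f ∈ R.succ e := by
      rw [List.isChain_cons_cons]
      exact ⟨fun h => ⟨h.2.1, h.1.2, h.2.2⟩, fun h => ⟨⟨R.o_eq_of_mem_succ h.1, h.2.1⟩, h.1, h.2.2⟩⟩
    rw [ncard_length_eq_succ (R.succ e) (fun f p hp => ((hcons f p).1 hp).1)
      fun f _ => (R.finite_walks f n).subset fun p hp => ⟨((hcons f p).1 hp.1).2.2, hp.2⟩]
    rw [Function.iterate_succ_apply', pow_succ, mul_assoc, ← R.sum_succ hc, Finset.mul_sum,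
      Nat.cast_sum]
    refine Finset.sum_congr rfl fun f hf => ?_
    simp_rw [← ih f, hcons, hf, true_and]

theorem numClosed_succ (hc : 0 < c) (h : Γ.IsRegular d) (x₀ : V) (n : ℕ) :
    (R.numClosed x₀ (n + 1) : ℝ) = c ^ n * ∑ e ∈ h.star x₀, R.mean^[n] (endsAt Γ x₀) e := by
  have hcons (e : E) (p : List E) :
      (Γ.IsPath x₀ (e :: p) x₀ ∧ (e :: p).IsChain fun e f => f ∈ R.succ e) ↔
        e ∈ h.star x₀ ∧ Γ.IsPath (Γ.t e) p x₀ ∧ (e :: p).IsChain fun e f => f ∈ R.succ e := by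
    rw [h.mem_star, ← and_assoc, IsPath]
  rw [numClosed, ncard_length_eq_succ (h.star x₀) (fun e p hp => ((hcons e p).1 hp).1)
      fun e _ => (R.finite_walks e n).subset fun p hp => ⟨((hcons e p).1 hp.1).2.2, hp.2⟩,
    Nat.cast_sum, Finset.mul_sum]
  refine Finset.sum_congr rfl fun e he => ?_
  simp_rw [← R.ncard_walks hc, hcons, he, true_and]

theorem numClosed_succ_le (hc : 0 < c) (h : Γ.IsRegular d) (x₀ : V) (n : ℕ) :
    (R.numClosed x₀ (n + 1) : ℝ) ≤ d * c ^ n := by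
  rw [R.numClosed_succ hc h, mul_comm]
  gcongr
  simpa [h.card_star] using
    Finset.sum_le_sum fun e (_ : e ∈ h.star x₀) => R.iterate_mean_le_one (endsAt_le_one x₀) n e

theorem numClosed_zero (x₀ : V) : R.numClosed x₀ 0 = 1 := by
  have hnil : {p | (Γ.IsPath x₀ p x₀ ∧ p.IsChain fun e f => f ∈ R.succ e) ∧
      p.length = 0} = {[]} := by
    ext p
    cases p <;> simp [IsPath]
  rw [numClosed, hnil, Set.ncard_singleton]

theorem numClosed_le (hc : 0 < c) (hdc : d ≤ 2 * c) (h : Γ.IsRegular d) (x₀ : V) (n : ℕ) :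
    R.numClosed x₀ n ≤ 2 * c ^ n := by
  cases n with
  | zero => simp [numClosed_zero]
  | succ n =>
    have hle : R.numClosed x₀ (n + 1) ≤ d * c ^ n := mod_cast R.numClosed_succ_le hc h x₀ n
    rw [pow_succ', ← mul_assoc]
    exact hle.trans (Nat.mul_le_mul_right _ hdc)

theorem numClosed_succ_of_subsingleton [Subsingleton V] (hc : 0 < c) (h : Γ.IsRegular d) (x₀ : V)
    (n : ℕ) : (R.numClosed x₀ (n + 1) : ℝ) = d * c ^ n := by
  have hends : endsAt Γ x₀ = 1 := funext fun e =>
    Set.indicator_of_mem (Subsingleton.elim (Γ.t e) x₀) 1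
  have hmean : R.mean 1 = 1 := by ext e; simp [RegularDigraph.mean, R.card_succ, hc.ne']
  rw [R.numClosed_succ hc h, hends, Function.iterate_fixed hmean]
  simp [h.card_star, mul_comm]

end Count

end WalkRule

section Mixing

variable {u : ℕ → E → ℝ}

theorem tendsto_sub_of_o_eq (h : Γ.IsRegular d) (hd : 2 < d)
    (hu : ∀ e f, Γ.o f = Γ.t e → f ≠ Γ.inv e →
      Tendsto (fun n => u n f - u (n + 1) e) atTop (𝓝 0))
    {f f' : E} (hf : Γ.o f = Γ.o f') : Tendsto (fun n => u n f - u n f') atTop (𝓝 0) := by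
  classical
  obtain ⟨g, hg, hgf⟩ : ∃ g ∈ h.star (Γ.o f), g ∉ ({f, f'} : Finset E) :=
    Finset.exists_mem_notMem_of_card_lt_card
      (Finset.card_le_two.trans_lt (hd.trans_eq (h.card_star _).symm))
  simp only [h.mem_star, Finset.mem_insert, Finset.mem_singleton, not_or] at hg hgf
  have hto : Γ.t (Γ.inv g) = Γ.o f := (Γ.t_inv g).trans hg
  have h1 := hu (Γ.inv g) f hto.symm (by simpa only [Γ.inv_inv] using Ne.symm hgf.1)
  have h2 := hu (Γ.inv g) f' (hto.trans hf).symm (by simpa only [Γ.inv_inv] using Ne.symm hgf.2)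
  simpa using h1.sub h2

theorem tendsto_sub_succ_of_o_eq_t (h : Γ.IsRegular d) (hd : 2 < d)
    (hu : ∀ e f, Γ.o f = Γ.t e → f ≠ Γ.inv e →
      Tendsto (fun n => u n f - u (n + 1) e) atTop (𝓝 0))
    {e f : E} (hf : Γ.o f = Γ.t e) : Tendsto (fun n => u n f - u (n + 1) e) atTop (𝓝 0) := by
  obtain ⟨f', hf', hne⟩ := (h.star (Γ.o f)).exists_mem_ne
    (by rw [h.card_star]; exact one_lt_two.trans hd) (Γ.inv e)
  rw [h.mem_star] at hf'
  simpa using (tendsto_sub_of_o_eq h hd hu hf'.symm).add (hu e f' (hf'.trans hf) hne)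

/-- Two consecutive times are added because, in a bipartite graph, parity prevents `u n` itself from
becoming constant. -/
theorem tendsto_add_succ_sub (h : Γ.IsRegular d) (hd : 2 < d) (hconn : Γ.IsConnected)
    (hu : ∀ e f, Γ.o f = Γ.t e → f ≠ Γ.inv e →
      Tendsto (fun n => u n f - u (n + 1) e) atTop (𝓝 0)) (e f : E) :
    Tendsto (fun n => (u n + u (n + 1)) e - (u n + u (n + 1)) f) atTop (𝓝 0) := by
  have hadj {e f : E} (hf : Γ.o f = Γ.t e) :
      Tendsto (fun n => (u n + u (n + 1)) e - (u n + u (n + 1)) f) atTop (𝓝 0) := by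
    have h1 := tendsto_sub_succ_of_o_eq_t h hd hu hf
    have h2 := tendsto_sub_succ_of_o_eq_t h hd hu (Γ.t_inv e).symm
    have h3 := (tendsto_sub_of_o_eq h hd hu ((Γ.o_inv e).trans hf.symm)).comp
      (tendsto_add_atTop_nat 1)
    convert (h2.add h3).sub h1 using 2
    · simp only [Pi.add_apply, Function.comp_apply]
      ring
    · simp
  obtain ⟨p, hp⟩ := hconn (Γ.t e) (Γ.o f)
  induction p generalizing e with
  | nil => exact hadj hp.symm
  | cons g p ih => simpa using (hadj hp.1).add (ih g hp.2)

end Mixing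

namespace WalkRule

variable (R : Γ.WalkRule c)

theorem tendsto_numClosed_add (hc : 0 < c) (h : Γ.IsRegular d) (hd : 2 < d)
    (hconn : Γ.IsConnected) (x₀ : V) :
    Tendsto (fun n => (R.numClosed x₀ (n + 1) : ℝ) / c ^ (n + 1) +
      R.numClosed x₀ (n + 2) / c ^ (n + 2)) atTop (𝓝 (d * (2 * d / Nat.card E) / c)) := by
  let u (n : ℕ) : E → ℝ := R.mean^[n] (endsAt Γ x₀)
  have hsq : endsAt Γ x₀ ^ 2 = endsAt Γ x₀ := by
    ext e
    by_cases he : Γ.t e = x₀ <;> simp [endsAt, he]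
  have hu (e f : E) (hf : Γ.o f = Γ.t e) (hne : f ≠ Γ.inv e) :
      Tendsto (fun n => u n f - u (n + 1) e) atTop (𝓝 0) :=
    R.tendsto_iterate_mean_sub hc (hsq.symm ▸ (hasSum_endsAt h x₀).summable)
      (R.mem_succ_of_ne_inv hf hne)
  have hnonneg (n : ℕ) : 0 ≤ u n := R.iterate_mean_nonneg (endsAt_nonneg x₀) n
  have hsum (n : ℕ) : HasSum (u n) d :=
    R.hasSum_iterate_mean hc (endsAt_nonneg x₀) (hasSum_endsAt h x₀) n
  have hlim (e : E) : Tendsto (fun n => (u n + u (n + 1)) e) atTop (𝓝 (2 * d / Nat.card E)) :=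
    tendsto_total_div_card (fun n => add_nonneg (hnonneg n) (hnonneg (n + 1)))
      (fun n => two_mul (d : ℝ) ▸ (hsum n).add (hsum (n + 1)))
      (tendsto_add_succ_sub h hd hconn hu) e
  have hstar := (tendsto_finsetSum (h.star x₀) fun e _ => hlim e).div_const (c : ℝ)
  rw [Finset.sum_const, h.card_star, nsmul_eq_mul] at hstar
  refine hstar.congr fun n => ?_
  have hc' : (c : ℝ) ≠ 0 := by positivity
  simp only [R.numClosed_succ hc h, Pi.add_apply, Finset.sum_add_distrib, u]
  field_simp
  ring

theorem tendsto_numClosed_div [Infinite E] (hc : 0 < c) (h : Γ.IsRegular d) (hd : 2 < d)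
    (hconn : Γ.IsConnected) (x₀ : V) :
    Tendsto (fun n => (R.numClosed x₀ n : ℝ) / c ^ n) atTop (𝓝 0) := by
  have hadd := R.tendsto_numClosed_add hc h hd hconn x₀
  rw [Nat.card_eq_zero_of_infinite, Nat.cast_zero, div_zero, mul_zero, zero_div] at hadd
  rw [← tendsto_add_atTop_iff_nat 1]
  exact squeeze_zero (fun n => by positivity)
    (fun n => le_add_of_nonneg_right (by positivity)) hadd

theorem not_tendsto_numClosed_div [Finite E] [Nonempty E] (hc : 0 < c) (h : Γ.IsRegular d)
    (hd : 2 < d) (hconn : Γ.IsConnected) (x₀ : V) :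
    ¬ Tendsto (fun n => (R.numClosed x₀ n : ℝ) / c ^ n) atTop (𝓝 0) := fun hzero => by
  have hadd := (hzero.comp (tendsto_add_atTop_nat 1)).add (hzero.comp (tendsto_add_atTop_nat 2))
  have heq := tendsto_nhds_unique hadd (R.tendsto_numClosed_add hc h hd hconn x₀)
  have : 0 < d := by lia
  have : 0 < Nat.card E := Nat.card_pos
  have hpos : 0 < d * (2 * d / Nat.card E : ℝ) / c := by positivity
  simp [← heq] at hpos

end WalkRule

theorem IsPath.isChain_congr {S T : E → E → Prop} (hST : ∀ e f, Γ.o f = Γ.t e → (S e f ↔ T e f))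
    {u v : V} {p : List E} (hp : Γ.IsPath u p v) : p.IsChain S ↔ p.IsChain T := by
  induction p generalizing u with
  | nil => simp
  | cons e p ih =>
    cases p with
    | nil => simp
    | cons f p => rw [List.isChain_cons_cons, List.isChain_cons_cons, hST e f hp.2.1, ih hp.2]

theorem IsRegular.numClosedPaths_eq (h : Γ.IsRegular d) (x₀ : V) (n : ℕ) :
    Γ.numClosedPaths x₀ n = h.walkRule.numClosed x₀ n := by
  refine congrArg Set.ncard (Set.ext fun p => and_congr_left' (iff_self_and.2 fun hp => ?_))
  exact (hp.isChain_congr fun e f hf => iff_of_true trivial (h.mem_star.2 hf)).1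
    (List.pairwise_of_forall fun _ _ => trivial).isChain

theorem IsRegular.numReducedClosedPaths_eq (h : Γ.IsRegular d) (x₀ : V) (n : ℕ) :
    Γ.numReducedClosedPaths x₀ n = h.reducedWalkRule.numClosed x₀ n := by
  classical
  refine congrArg Set.ncard (Set.ext fun p => ?_)
  refine and_assoc.symm.trans (and_congr_left' (and_congr_right fun hp => ?_))
  refine hp.isChain_congr fun e f hf => ?_
  exact (Finset.mem_erase.trans (and_iff_left (h.mem_star.2 hf))).symm

theorem IsRegular.nonReducedCogrowthRate_le (h : Γ.IsRegular d) (hd : 0 < d) (x₀ : V) :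
    Γ.nonReducedCogrowthRate x₀ ≤ d :=
  limsup_root_le two_ne_zero fun n =>
    (h.numClosedPaths_eq x₀ n).trans_le (h.walkRule.numClosed_le hd (by lia) h x₀ n)

theorem IsRegular.cogrowthRate_le (h : Γ.IsRegular d) (hd : 2 ≤ d) (x₀ : V) :
    Γ.cogrowthRate x₀ ≤ (d - 1 : ℕ) :=
  limsup_root_le two_ne_zero fun n => (h.numReducedClosedPaths_eq x₀ n).trans_le
    (h.reducedWalkRule.numClosed_le (by lia) (by lia) h x₀ n)

end SerreGraph

/-! ### The coset graph and its words -/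

namespace CosetGraph

variable {A : Type*} {H : Subgroup (FreeGroup A)}

theorem mulRight_base_eq_base_iff {g : FreeGroup A} : mulRight H (base H) g = base H ↔ g ∈ H := by
  refine Quotient.eq''.trans ?_
  rw [QuotientGroup.rightRel_apply]
  simp

theorem exists_mulRight_eq (u v : Vertex H) : ∃ g, mulRight H u g = v := by
  induction u, v using Quotient.inductionOn₂' with
  | h x y => exact ⟨x⁻¹ * y, congrArg Quotient.mk'' (mul_inv_cancel_left x y)⟩

theorem ne_invLetter_iff {l m : A × Bool} : m ≠ invLetter l ↔ (l.1 = m.1 → l.2 = m.2) := by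
  obtain ⟨x, b⟩ := l
  obtain ⟨y, c⟩ := m
  simp only [invLetter, ne_eq, Prod.mk.injEq, not_and, Bool.not_eq_not, eq_comm]

/-- The edge-path that starts at `v` and is labelled by the word `w`. -/
def pathFrom : Vertex H → List (A × Bool) → List (Vertex H × (A × Bool))
  | _, [] => []
  | v, l :: w => (v, l) :: pathFrom (mulRight H v (FreeGroup.mk [l])) w

theorem map_snd_pathFrom (v : Vertex H) (w : List (A × Bool)) :
    (pathFrom v w).map Prod.snd = w := by
  induction w generalizing v with
  | nil => rfl
  | cons l w ih => simp [pathFrom, ih]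

theorem length_pathFrom (v : Vertex H) (w : List (A × Bool)) :
    (pathFrom v w).length = w.length := by
  rw [← List.length_map Prod.snd, map_snd_pathFrom]

theorem pathFrom_injective (v : Vertex H) : Function.Injective (pathFrom v) :=
  Function.LeftInverse.injective (g := List.map Prod.snd) (map_snd_pathFrom v)

theorem isPath_pathFrom_iff {u v : Vertex H} {w : List (A × Bool)} :
    (graph H).IsPath u (pathFrom u w) v ↔ mulRight H u (FreeGroup.mk w) = v := by
  induction w generalizing u with
  | nil => exact Eq.congr_left (mulRight_one H u).symm
  | cons l w ih =>
    rw [← List.singleton_append, ← FreeGroup.mul_mk, ← mulRight_mul, ← ih]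
    exact and_iff_right rfl

theorem eq_pathFrom_of_isPath {u v : Vertex H} {p : List (Vertex H × (A × Bool))}
    (hp : (graph H).IsPath u p v) : p = pathFrom u (p.map Prod.snd) := by
  induction p generalizing u with
  | nil => rfl
  | cons e p ih =>
    obtain ⟨x, l⟩ := e
    obtain ⟨rfl, h⟩ := hp
    exact congrArg _ (ih h)

theorem isReduced_pathFrom_iff {v : Vertex H} {w : List (A × Bool)} :
    (graph H).IsReduced (pathFrom v w) ↔ FreeGroup.IsReduced w := by
  induction w generalizing v with
  | nil => simp [pathFrom, SerreGraph.IsReduced]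
  | cons l w ih =>
    cases w with
    | nil => simp [pathFrom, SerreGraph.IsReduced]
    | cons m w =>
      refine List.isChain_cons_cons.trans (.trans (and_congr ?_ ih) List.isChain_cons_cons.symm)
      rw [← ne_invLetter_iff]
      exact not_congr Prod.mk_right_inj

theorem isConnected_graph : (graph H).IsConnected := fun u v => by
  obtain ⟨g, rfl⟩ := exists_mulRight_eq u v
  induction g using Quot.inductionOn with
  | h w => exact ⟨pathFrom u w, isPath_pathFrom_iff.2 rfl⟩

theorem ncard_closedPaths {P : List (Vertex H × (A × Bool)) → Prop} {Q : List (A × Bool) → Prop}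
    (hPQ : ∀ w, P (pathFrom (base H) w) ↔ Q w) :
    {p | (graph H).IsPath (base H) p (base H) ∧ P p}.ncard =
      {w | w ∈ wordsRepresenting H ∧ Q w}.ncard := by
  rw [← Set.ncard_image_of_injective _ (pathFrom_injective (base H))]
  have hiff (w : List (A × Bool)) : (graph H).IsPath (base H) (pathFrom (base H) w) (base H) ∧
      P (pathFrom (base H) w) ↔ w ∈ wordsRepresenting H ∧ Q w :=
    and_congr (isPath_pathFrom_iff.trans mulRight_base_eq_base_iff) (hPQ w)
  refine congrArg Set.ncard (Set.ext fun p => ⟨fun hp => ?_, ?_⟩)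
  · obtain ⟨w, rfl⟩ : ∃ w, p = pathFrom (base H) w := ⟨_, eq_pathFrom_of_isPath hp.1⟩
    exact ⟨w, (hiff w).1 hp, rfl⟩
  · rintro ⟨w, hw, rfl⟩
    exact (hiff w).2 hw

theorem numClosedPaths_eq (n : ℕ) : (graph H).numClosedPaths (base H) n = numWords H n :=
  ncard_closedPaths fun w => by rw [length_pathFrom]

theorem numReducedClosedPaths_eq (n : ℕ) :
    (graph H).numReducedClosedPaths (base H) n = numReducedWords H n :=
  ncard_closedPaths fun w => by rw [length_pathFrom, isReduced_pathFrom_iff]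

theorem infinite_vertex_iff : Infinite (Vertex H) ↔ ¬ H.FiniteIndex := by
  rw [Subgroup.finiteIndex_iff_finite_quotient, ← not_finite_iff_infinite,
    (QuotientGroup.quotientRightRelEquivQuotientLeftRel H).finite_iff]

variable [Fintype A]

theorem isRegular_graph : (graph H).IsRegular (2 * Fintype.card A) := fun v => by
  have hstar : {e | (graph H).o e = v} = Set.range (Prod.mk v) := by
    ext ⟨u, l⟩
    exact ⟨fun h => ⟨l, congrArg (·, l) h.symm⟩, fun ⟨_, h⟩ => (congrArg Prod.fst h).symm⟩
  rw [hstar, ← Set.image_univ, (Prod.mk_right_injective v).encard_image, Set.encard_univ,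
    ENat.card_eq_coe_fintype_card, Fintype.card_prod, Fintype.card_bool, mul_comm]

theorem numWords_eq (n : ℕ) :
    numWords H n = isRegular_graph.walkRule.numClosed (base H) n := by
  rw [← numClosedPaths_eq, isRegular_graph.numClosedPaths_eq]

theorem numReducedWords_eq (n : ℕ) :
    numReducedWords H n = isRegular_graph.reducedWalkRule.numClosed (base H) n := by
  rw [← numReducedClosedPaths_eq, isRegular_graph.numReducedClosedPaths_eq]

end CosetGraph

section CumulativeCounts

variable {A : Type*} (H : Subgroup (FreeGroup A))

theorem numReducedWords_zero : numReducedWords H 0 = 1 := by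
  have hnil : {w | w ∈ wordsRepresenting H ∧ FreeGroup.IsReduced w ∧ w.length = 0} = {[]} := by
    ext w
    cases w <;> simp [wordsRepresenting, ← FreeGroup.one_eq_mk, H.one_mem]
  rw [numReducedWords, hnil, Set.ncard_singleton]

theorem ncard_norm_eq_ncard_length [DecidableEq A] (P : ℕ → Prop) :
    {g | g ∈ H ∧ P g.norm}.ncard =
      {w | w ∈ wordsRepresenting H ∧ FreeGroup.IsReduced w ∧ P w.length}.ncard := by
  rw [← Set.ncard_image_of_injective _ (FreeGroup.toWord_injective (α := A))]
  refine congrArg Set.ncard (Set.ext fun w => ⟨?_, fun ⟨hw, hred, hP⟩ => ?_⟩)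
  · rintro ⟨g, ⟨hg, hP⟩, rfl⟩
    exact ⟨by rwa [wordsRepresenting, Set.mem_ofPred_eq, FreeGroup.mk_toWord],
      FreeGroup.isReduced_toWord, hP⟩
  · have hword : (FreeGroup.mk w).toWord = w := FreeGroup.toWord_mk.trans hred.reduce_eq
    exact ⟨FreeGroup.mk w, ⟨hw, by rwa [FreeGroup.norm, hword]⟩, hword⟩

theorem ncard_inter_freeBall [DecidableEq A] (n : ℕ) :
    ((H : Set (FreeGroup A)) ∩ freeBall A n).ncard = numReducedWordsLE H n :=
  ncard_norm_eq_ncard_length H (· ≤ n)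

variable [Finite A]

theorem numWordsLE_eq_sum (n : ℕ) :
    numWordsLE H n = ∑ i ∈ Finset.range (n + 1), numWords H i :=
  ncard_length_le

theorem numReducedWordsLE_eq_sum (n : ℕ) :
    numReducedWordsLE H n = ∑ i ∈ Finset.range (n + 1), numReducedWords H i := by
  simpa only [and_assoc, numReducedWordsLE, numReducedWords] using
    ncard_length_le (P := fun w => w ∈ wordsRepresenting H ∧ FreeGroup.IsReduced w)

theorem numWords_le_numWordsLE (n : ℕ) : numWords H n ≤ numWordsLE H n :=
  numWordsLE_eq_sum H n ▸ Finset.single_le_sum_of_canonicallyOrdered (Finset.self_mem_range_succ n)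

theorem numReducedWords_le_numReducedWordsLE (n : ℕ) :
    numReducedWords H n ≤ numReducedWordsLE H n :=
  numReducedWordsLE_eq_sum H n ▸
    Finset.single_le_sum_of_canonicallyOrdered (Finset.self_mem_range_succ n)

theorem ncard_freeBall_eq_sum [DecidableEq A] (n : ℕ) :
    (freeBall A n).ncard =
      ∑ i ∈ Finset.range (n + 1), numReducedWords (⊤ : Subgroup (FreeGroup A)) i := by
  rw [← numReducedWordsLE_eq_sum, ← ncard_inter_freeBall, Subgroup.coe_top, Set.univ_inter]

variable {H}

theorem growsSlowerThan_numWordsLE {q : ℝ} (h : GrowsSlowerThan (numWords H) q) :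
    GrowsSlowerThan (numWordsLE H) q := by
  simpa only [← numWordsLE_eq_sum] using h.sum_range

theorem growsSlowerThan_numReducedWordsLE {q : ℝ} (h : GrowsSlowerThan (numReducedWords H) q) :
    GrowsSlowerThan (numReducedWordsLE H) q := by
  simpa only [← numReducedWordsLE_eq_sum] using h.sum_range

end CumulativeCounts

section Counts

open CosetGraph

variable {A : Type*} [Fintype A] {H : Subgroup (FreeGroup A)}

theorem tendsto_numWords_div (hA : 2 ≤ Fintype.card A) (hH : ¬ H.FiniteIndex) :
    Tendsto (fun n => (numWords H n : ℝ) / (2 * Fintype.card A) ^ n) atTop (𝓝 0) := by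
  have := infinite_vertex_iff.2 hH
  have : Nonempty A := Fintype.card_pos_iff.1 (by lia)
  simpa [numWords_eq] using isRegular_graph.walkRule.tendsto_numClosed_div (by lia)
    isRegular_graph (by lia) isConnected_graph (base H)

theorem not_tendsto_numWords_div (hA : 2 ≤ Fintype.card A) (hH : H.FiniteIndex) :
    ¬ Tendsto (fun n => (numWords H n : ℝ) / (2 * Fintype.card A) ^ n) atTop (𝓝 0) := by
  have : Finite (Vertex H) := not_infinite_iff_finite.1 (mt infinite_vertex_iff.1 (not_not.2 hH))
  have : Nonempty A := Fintype.card_pos_iff.1 (by lia)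
  have : Nonempty (Vertex H) := ⟨base H⟩
  simpa [numWords_eq] using isRegular_graph.walkRule.not_tendsto_numClosed_div (by lia)
    isRegular_graph (by lia) isConnected_graph (base H)

theorem cast_two_mul_card_sub_one [Nonempty A] :
    ((2 * Fintype.card A - 1 : ℕ) : ℝ) = 2 * Fintype.card A - 1 := by
  have := Fintype.card_pos (α := A)
  rw [Nat.cast_pred (by lia), Nat.cast_mul, Nat.cast_two]

theorem tendsto_numReducedWords_div (hA : 2 ≤ Fintype.card A) (hH : ¬ H.FiniteIndex) :
    Tendsto (fun n => (numReducedWords H n : ℝ) / (2 * Fintype.card A - 1) ^ n) atTop (𝓝 0) := by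
  have := infinite_vertex_iff.2 hH
  have : Nonempty A := Fintype.card_pos_iff.1 (by lia)
  simpa [numReducedWords_eq, cast_two_mul_card_sub_one] using
    isRegular_graph.reducedWalkRule.tendsto_numClosed_div (by lia)
      isRegular_graph (by lia) isConnected_graph (base H)

theorem not_tendsto_numReducedWords_div (hA : 2 ≤ Fintype.card A) (hH : H.FiniteIndex) :
    ¬ Tendsto (fun n => (numReducedWords H n : ℝ) / (2 * Fintype.card A - 1) ^ n)
      atTop (𝓝 0) := by
  have : Finite (Vertex H) := not_infinite_iff_finite.1 (mt infinite_vertex_iff.1 (not_not.2 hH))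
  have : Nonempty A := Fintype.card_pos_iff.1 (by lia)
  have : Nonempty (Vertex H) := ⟨base H⟩
  simpa [numReducedWords_eq, cast_two_mul_card_sub_one] using
    isRegular_graph.reducedWalkRule.not_tendsto_numClosed_div (by lia)
      isRegular_graph (by lia) isConnected_graph (base H)

variable (H)

theorem numWords_le [Nonempty A] (n : ℕ) :
    (numWords H n : ℝ) ≤ 2 * (2 * Fintype.card A) ^ n := by
  rw [numWords_eq]
  exact_mod_cast isRegular_graph.walkRule.numClosed_le (by simp [Fintype.card_pos]) (by lia)
    isRegular_graph (base H) n

theorem numReducedWords_le [Nonempty A] (n : ℕ) :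
    (numReducedWords H n : ℝ) ≤ 2 * (2 * Fintype.card A - 1) ^ n := by
  have := Fintype.card_pos (α := A)
  rw [numReducedWords_eq, ← cast_two_mul_card_sub_one]
  exact_mod_cast isRegular_graph.reducedWalkRule.numClosed_le (by lia) (by lia) isRegular_graph
    (base H) n

theorem numReducedWords_top_succ [Nonempty A] (n : ℕ) :
    (numReducedWords (⊤ : Subgroup (FreeGroup A)) (n + 1) : ℝ) =
      2 * Fintype.card A * (2 * Fintype.card A - 1) ^ n := by
  have := Fintype.card_pos (α := A)
  have hbase (v : Vertex (⊤ : Subgroup (FreeGroup A))) : v = base ⊤ := by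
    obtain ⟨g, rfl⟩ := exists_mulRight_eq (base ⊤) v
    exact mulRight_base_eq_base_iff.2 (Subgroup.mem_top g)
  have : Subsingleton (Vertex (⊤ : Subgroup (FreeGroup A))) :=
    ⟨fun u v => (hbase u).trans (hbase v).symm⟩
  rw [numReducedWords_eq, isRegular_graph.reducedWalkRule.numClosed_succ_of_subsingleton (by lia)
    isRegular_graph, cast_two_mul_card_sub_one, Nat.cast_mul, Nat.cast_two]

theorem wordDensity_le [Nonempty A] (n : ℕ) :
    wordDensity (wordsRepresenting H) n ≤ (numWordsLE H n : ℝ) / (2 * Fintype.card A) ^ n := by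
  have hcard : {w : List (A × Bool) | w.length = n}.ncard = (2 * Fintype.card A) ^ n := by
    rw [← Nat.card_coe_set_eq, mul_comm 2, ← Fintype.card_bool, ← Fintype.card_prod]
    exact (Nat.card_eq_fintype_card (α := List.Vector (A × Bool) n)).trans (card_vector n)
  have hle : (2 * Fintype.card A) ^ n ≤ {w : List (A × Bool) | w.length ≤ n}.ncard :=
    hcard ▸ Set.ncard_le_ncard (fun w hw => le_of_eq hw) (List.finite_length_le _ n)
  refine div_le_div_of_nonneg_left (Nat.cast_nonneg _) ?_ (mod_cast hle)
  have := Fintype.card_pos (α := A)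
  positivity

variable [DecidableEq A]

theorem ncard_freeBall (hA : 2 ≤ Fintype.card A) (n : ℕ) :
    ((freeBall A n).ncard : ℝ) = 1 + (Fintype.card A : ℝ) / (Fintype.card A - 1) *
      ((2 * Fintype.card A - 1) ^ n - 1) := by
  have : Nonempty A := Fintype.card_pos_iff.1 (by lia)
  have hA' : (Fintype.card A : ℝ) - 1 ≠ 0 := by
    rw [sub_ne_zero, Nat.cast_ne_one]
    lia
  rw [ncard_freeBall_eq_sum]
  induction n with
  | zero => simp [numReducedWords_zero]
  | succ n ih =>
    rw [Finset.sum_range_succ, Nat.cast_add, ih, numReducedWords_top_succ]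
    field_simp
    ring

theorem ballDensity_le (hA : 2 ≤ Fintype.card A) (n : ℕ) :
    ballDensity (H : Set (FreeGroup A)) n ≤
      (numReducedWordsLE H n : ℝ) / (2 * Fintype.card A - 1) ^ n := by
  have hA' : (2 : ℝ) ≤ Fintype.card A := mod_cast hA
  have hpow : (1 : ℝ) ≤ (2 * Fintype.card A - 1) ^ n := one_le_pow₀ (by linarith)
  rw [ballDensity, ncard_inter_freeBall]
  refine div_le_div_of_nonneg_left (Nat.cast_nonneg _) (by linarith) ?_
  have hratio : 1 ≤ (Fintype.card A : ℝ) / (Fintype.card A - 1) :=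
    (one_le_div (by linarith)).2 (by linarith)
  have := mul_le_mul_of_nonneg_right hratio (sub_nonneg.2 hpow)
  rw [ncard_freeBall hA]
  linarith

end Counts

/-! ### Comparison of the two cogrowth rates -/

section Cogrowth

variable {A : Type*}

/-- The number of words of length `m` that represent `g`. -/
noncomputable def numWordsFor (g : FreeGroup A) (m : ℕ) : ℕ :=
  {w | FreeGroup.mk w = g ∧ w.length = m}.ncard

theorem numWordsFor_one_zero : numWordsFor (1 : FreeGroup A) 0 = 1 := by
  have hnil : {w : List (A × Bool) | FreeGroup.mk w = 1 ∧ w.length = 0} = {[]} := by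
    ext w
    cases w <;> simp [← FreeGroup.one_eq_mk]
  rw [numWordsFor, hnil, Set.ncard_singleton]

theorem sum_numWordsFor_le [Finite A] {H : Subgroup (FreeGroup A)} {S : Finset (FreeGroup A)}
    (hS : ∀ g ∈ S, g ∈ H) (m : ℕ) : ∑ g ∈ S, numWordsFor g m ≤ numWords H m := by
  have hfin (P : List (A × Bool) → Prop) : {w | P w ∧ w.length = m}.Finite :=
    (List.finite_length_eq _ m).subset fun _ hw => hw.2
  have hdisj : (S : Set (FreeGroup A)).PairwiseDisjoint fun g =>
      {w | FreeGroup.mk w = g ∧ w.length = m} := fun g _ g' _ hne =>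
    Set.disjoint_left.2 fun w hw hw' => hne (hw.1.symm.trans hw'.1)
  have hunion := S.finite_toSet.ncard_biUnion (fun g _ => hfin _) hdisj
  rw [finsum_mem_coe_finset] at hunion
  refine hunion.symm.trans_le (Set.ncard_le_ncard (Set.iUnion₂_subset ?_) (hfin _))
  rintro g hg w ⟨rfl, hw⟩
  exact ⟨hS _ hg, hw⟩

/-- The Green function `∑ m, numWordsFor g m / s ^ m` of the Cayley graph, cut off before
`m = M`. -/
noncomputable def truncatedGreen (s : ℝ) (M : ℕ) (g : FreeGroup A) : ℝ :=
  ∑ m ∈ Finset.range M, numWordsFor g m / s ^ m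

theorem one_le_truncatedGreen_one {s : ℝ} (hs : 0 ≤ s) (M : ℕ) :
    1 ≤ truncatedGreen s (M + 1) (1 : FreeGroup A) := by
  rw [truncatedGreen, Finset.sum_range_succ', numWordsFor_one_zero, pow_zero, Nat.cast_one,
    div_one]
  exact le_add_of_nonneg_left (by positivity)

section Fintype

variable [Fintype A]

theorem numWordsFor_succ (g : FreeGroup A) (m : ℕ) :
    numWordsFor g (m + 1) = ∑ l, numWordsFor ((FreeGroup.mk [l])⁻¹ * g) m := by
  rw [numWordsFor, ncard_length_eq_succ Finset.univ (fun l _ _ => Finset.mem_univ l)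
    fun _ _ => (List.finite_length_eq _ m).subset fun _ hw => hw.2]
  refine Finset.sum_congr rfl fun l _ => congrArg Set.ncard (Set.ext fun w => ?_)
  rw [Set.mem_ofPred_eq, ← List.singleton_append, ← FreeGroup.mul_mk, ← eq_inv_mul_iff_mul_eq]
  rfl

theorem sum_truncatedGreen_le {s : ℝ} (hs : 0 < s) (M : ℕ) (g : FreeGroup A) :
    ∑ l, truncatedGreen s M ((FreeGroup.mk [l])⁻¹ * g) ≤ s * truncatedGreen s (M + 1) g := by
  simp only [truncatedGreen]
  rw [Finset.sum_range_succ', mul_add, Finset.mul_sum, Finset.sum_comm]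
  refine le_add_of_le_of_nonneg (Finset.sum_le_sum fun m _ => ?_) (by positivity)
  rw [numWordsFor_succ, Nat.cast_sum, ← Finset.sum_div, pow_succ']
  field_simp
  rfl

variable (A) in
/-- The number `(2k - 1)ρ + ρ⁻¹`: on the Cayley graph of the free group of rank `k`, the function
`g ↦ ρ ^ |g|` is, away from the identity, an eigenfunction of the adjacency operator with this
eigenvalue. -/
noncomputable def radialEigenvalue (ρ : ℝ) : ℝ :=
  (2 * Fintype.card A - 1) * ρ + ρ⁻¹

theorem radialEigenvalue_pos [Nonempty A] {ρ : ℝ} (hρ : 0 < ρ) : 0 < radialEigenvalue A ρ := by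
  rw [radialEigenvalue, ← cast_two_mul_card_sub_one]
  positivity

end Fintype

section Norm

variable [DecidableEq A]

theorem norm_inv_letter_mul_of_head {g : FreeGroup A} {l : A × Bool}
    (hl : g.toWord.head? = some l) : ((FreeGroup.mk [l])⁻¹ * g).norm + 1 = g.norm := by
  obtain ⟨w, hw⟩ := List.head?_eq_some_iff.1 hl
  have hred : FreeGroup.IsReduced w := (hw ▸ FreeGroup.isReduced_toWord (x := g)).tail
  have hg : (FreeGroup.mk [l])⁻¹ * g = FreeGroup.mk w := by
    rw [inv_mul_eq_iff_eq_mul, FreeGroup.mul_mk, List.singleton_append, ← hw, FreeGroup.mk_toWord]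
  rw [hg, FreeGroup.norm, FreeGroup.toWord_mk, hred.reduce_eq, FreeGroup.norm, hw, List.length_cons]

theorem norm_inv_letter_mul_of_head_ne {g : FreeGroup A} {l : A × Bool}
    (hl : g.toWord.head? ≠ some l) : ((FreeGroup.mk [l])⁻¹ * g).norm = g.norm + 1 := by
  have hred : FreeGroup.IsReduced (CosetGraph.invLetter l :: g.toWord) := by
    refine List.isChain_cons.2 ⟨fun m hm => CosetGraph.ne_invLetter_iff.1 fun h => hl ?_,
      FreeGroup.isReduced_toWord⟩
    rw [Option.mem_def.1 hm, h]
    simp [CosetGraph.invLetter]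
  have hg : (FreeGroup.mk [l])⁻¹ * g = FreeGroup.mk (CosetGraph.invLetter l :: g.toWord) := by
    rw [inv_mul_eq_iff_eq_mul, ← List.singleton_append (x := CosetGraph.invLetter l),
      ← FreeGroup.mul_mk, ← mul_assoc, CosetGraph.mk_letter_mul_inv, one_mul, FreeGroup.mk_toWord]
  rw [hg, FreeGroup.norm, FreeGroup.toWord_mk, hred.reduce_eq, List.length_cons, FreeGroup.norm]

variable [Fintype A]

theorem sum_pow_norm_of_ne_one {ρ : ℝ} (hρ : ρ ≠ 0) {g : FreeGroup A} (hg : g ≠ 1) :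
    ∑ l, ρ ^ ((FreeGroup.mk [l])⁻¹ * g).norm = radialEigenvalue A ρ * ρ ^ g.norm := by
  obtain ⟨l₀, hl₀⟩ : ∃ l, g.toWord.head? = some l :=
    Option.ne_none_iff_exists'.1 (mt List.head?_eq_none_iff.1 (by simpa using hg))
  have hother (l : A × Bool) (hl : l ∈ Finset.univ.erase l₀) :
      ρ ^ ((FreeGroup.mk [l])⁻¹ * g).norm = ρ ^ (g.norm + 1) := by
    rw [norm_inv_letter_mul_of_head_ne]
    exact fun h => Finset.ne_of_mem_erase hl (Option.some_inj.1 (h.symm.trans hl₀))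
  have hcard : ((Finset.univ.erase l₀).card : ℝ) = 2 * Fintype.card A - 1 := by
    have : Nonempty A := ⟨l₀.1⟩
    rw [Finset.card_erase_of_mem (Finset.mem_univ _), Finset.card_univ, Fintype.card_prod,
      Fintype.card_bool, mul_comm, cast_two_mul_card_sub_one]
  rw [← Finset.add_sum_erase _ _ (Finset.mem_univ l₀), Finset.sum_congr rfl hother,
    Finset.sum_const, nsmul_eq_mul, hcard, ← norm_inv_letter_mul_of_head hl₀, radialEigenvalue]
  field_simp
  ring

theorem sum_pow_norm_le {ρ : ℝ} (hρ0 : 0 < ρ) (hρ1 : ρ ≤ 1) (g : FreeGroup A) :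
    ∑ l, ρ ^ ((FreeGroup.mk [l])⁻¹ * g).norm ≤ radialEigenvalue A ρ * ρ ^ g.norm := by
  rcases eq_or_ne g 1 with rfl | hg
  · have hnorm (l : A × Bool) : ((FreeGroup.mk [l])⁻¹ * 1).norm = 1 := by
      rw [norm_inv_letter_mul_of_head_ne (by simp), FreeGroup.norm_one]
    have hle : ρ ≤ ρ⁻¹ := hρ1.trans ((one_le_inv₀ hρ0).2 hρ1)
    simp only [hnorm, FreeGroup.norm_one, radialEigenvalue, Finset.sum_const, Finset.card_univ,
      Fintype.card_prod, Fintype.card_bool, nsmul_eq_mul, Nat.cast_mul, Nat.cast_two]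
    linarith
  · exact (sum_pow_norm_of_ne_one hρ0.ne' hg).le

/-- Comparing with a second radius `ρ'` leaves a remainder that tends to zero as `M → ∞` whenever
`radialEigenvalue A ρ' < radialEigenvalue A ρ`. -/
theorem pow_norm_le_truncatedGreen_add [Nonempty A] {ρ ρ' : ℝ} (hρ : 0 < ρ) (hρρ' : ρ ≤ ρ')
    (hρ' : ρ' ≤ 1) (M : ℕ) (g : FreeGroup A) :
    ρ ^ g.norm ≤ truncatedGreen (radialEigenvalue A ρ) M g +
      (radialEigenvalue A ρ' / radialEigenvalue A ρ) ^ M * ρ' ^ g.norm := by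
  set ev := radialEigenvalue A ρ
  set ev' := radialEigenvalue A ρ'
  have hρ'0 : 0 < ρ' := hρ.trans_le hρρ'
  have hev : 0 < ev := radialEigenvalue_pos hρ
  have hev' : 0 < ev' := radialEigenvalue_pos hρ'0
  induction M generalizing g with
  | zero => simpa [truncatedGreen] using pow_le_pow_left₀ hρ.le hρρ' _
  | succ M ih =>
    rcases eq_or_ne g 1 with rfl | hg
    · rw [FreeGroup.norm_one, pow_zero]
      exact (one_le_truncatedGreen_one hev.le M).trans (le_add_of_nonneg_right (by positivity))
    refine le_of_mul_le_mul_left ?_ hev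
    calc ev * ρ ^ g.norm = ∑ l, ρ ^ ((FreeGroup.mk [l])⁻¹ * g).norm :=
          (sum_pow_norm_of_ne_one hρ.ne' hg).symm
      _ ≤ ∑ l, (truncatedGreen ev M ((FreeGroup.mk [l])⁻¹ * g) +
            (ev' / ev) ^ M * ρ' ^ ((FreeGroup.mk [l])⁻¹ * g).norm) :=
          Finset.sum_le_sum fun l _ => ih _
      _ = ∑ l, truncatedGreen ev M ((FreeGroup.mk [l])⁻¹ * g) +
            (ev' / ev) ^ M * ∑ l, ρ' ^ ((FreeGroup.mk [l])⁻¹ * g).norm := by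
          rw [Finset.sum_add_distrib, Finset.mul_sum]
      _ ≤ ev * truncatedGreen ev (M + 1) g + (ev' / ev) ^ M * (ev' * ρ' ^ g.norm) := by
          gcongr
          · exact sum_truncatedGreen_le hev M g
          · exact sum_pow_norm_le hρ'0 hρ' g
      _ = ev * (truncatedGreen ev (M + 1) g + (ev' / ev) ^ (M + 1) * ρ' ^ g.norm) := by
          rw [pow_succ]
          field_simp

theorem card_mul_pow_le [Nonempty A] {H : Subgroup (FreeGroup A)} {n : ℕ}
    {S : Finset (FreeGroup A)} (hSH : ∀ g ∈ S, g ∈ H) (hSn : ∀ g ∈ S, g.norm = n) {ρ ρ' : ℝ}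
    (hρ : 0 < ρ) (hρρ' : ρ ≤ ρ') (hρ' : ρ' ≤ 1) (M : ℕ) :
    S.card * ρ ^ n ≤ ∑ m ∈ Finset.range M, numWords H m / radialEigenvalue A ρ ^ m +
      (radialEigenvalue A ρ' / radialEigenvalue A ρ) ^ M * (S.card * ρ' ^ n) := by
  have hev : 0 < radialEigenvalue A ρ := radialEigenvalue_pos hρ
  have hgreen : ∑ g ∈ S, truncatedGreen (radialEigenvalue A ρ) M g ≤
      ∑ m ∈ Finset.range M, numWords H m / radialEigenvalue A ρ ^ m := by
    simp only [truncatedGreen]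
    rw [Finset.sum_comm]
    refine Finset.sum_le_sum fun m _ => ?_
    rw [← Finset.sum_div, ← Nat.cast_sum]
    gcongr
    exact sum_numWordsFor_le hSH m
  have hsum := Finset.sum_le_sum fun g (hg : g ∈ S) =>
    hSn g hg ▸ pow_norm_le_truncatedGreen_add hρ hρρ' hρ' M g
  rw [Finset.sum_add_distrib, Finset.sum_const, Finset.sum_const, nsmul_eq_mul, nsmul_eq_mul,
    mul_left_comm] at hsum
  exact hsum.trans (by gcongr)

end Norm

variable [Fintype A]

theorem numReducedWords_mul_pow_le [Nonempty A] {H : Subgroup (FreeGroup A)} {C r ρ ρ' : ℝ}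
    (hr : 0 ≤ r) (hH : ∀ m, (numWords H m : ℝ) ≤ C * r ^ m) (hρ : 0 < ρ) (hρρ' : ρ ≤ ρ')
    (hρ' : ρ' ≤ 1) (hev : radialEigenvalue A ρ' < radialEigenvalue A ρ)
    (hrρ : r < radialEigenvalue A ρ) (n : ℕ) :
    numReducedWords H n * ρ ^ n ≤ C * (1 - r / radialEigenvalue A ρ)⁻¹ := by
  classical
  have hev0 : 0 < radialEigenvalue A ρ := radialEigenvalue_pos hρ
  have hev'0 : 0 < radialEigenvalue A ρ' := radialEigenvalue_pos (hρ.trans_le hρρ')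
  have hfin : {g | g ∈ H ∧ g.norm = n}.Finite :=
    ((List.finite_length_eq _ n).preimage FreeGroup.toWord_injective.injOn).subset fun _ hg => hg.2
  have hcard : hfin.toFinset.card = numReducedWords H n :=
    (Set.ncard_eq_toFinset_card _ hfin).symm.trans (ncard_norm_eq_ncard_length H (· = n))
  have hgeom : HasSum (fun m => C * (r / radialEigenvalue A ρ) ^ m)
      (C * (1 - r / radialEigenvalue A ρ)⁻¹) :=
    (hasSum_geometric_of_lt_one (by positivity) ((div_lt_one hev0).2 hrρ)).mul_left C
  have hlim : Tendsto (fun M => ∑ m ∈ Finset.range M, C * (r / radialEigenvalue A ρ) ^ m +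
      (radialEigenvalue A ρ' / radialEigenvalue A ρ) ^ M * (numReducedWords H n * ρ' ^ n)) atTop
      (𝓝 (C * (1 - r / radialEigenvalue A ρ)⁻¹)) := by
    simpa using hgeom.tendsto_sum_nat.add ((tendsto_pow_atTop_nhds_zero_of_lt_one (by positivity)
      ((div_lt_one hev0).2 hev)).mul_const _)
  refine ge_of_tendsto' hlim fun M => ?_
  rw [← hcard]
  refine (card_mul_pow_le (fun g hg => (hfin.mem_toFinset.1 hg).1)
    (fun g hg => (hfin.mem_toFinset.1 hg).2) hρ hρρ' hρ' M).trans ?_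
  gcongr with m
  rw [div_pow, ← mul_div_assoc]
  gcongr
  exact hH m


theorem exists_radii_of_lt (hA : 2 ≤ Fintype.card A) {r : ℝ} (hr : r < 2 * Fintype.card A) :
    ∃ ρ ρ', (2 * Fintype.card A - 1 : ℝ)⁻¹ < ρ ∧ ρ < ρ' ∧ ρ' < 1 ∧
      radialEigenvalue A ρ' < radialEigenvalue A ρ ∧ r < radialEigenvalue A ρ := by
  have hk : (2 : ℝ) ≤ Fintype.card A := mod_cast hA
  have hk0 : (0 : ℝ) < (Fintype.card A : ℝ)⁻¹ := by positivity
  have hq : (0 : ℝ) < 2 * Fintype.card A - 1 := by linarith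
  have htop : radialEigenvalue A (2 * Fintype.card A - 1 : ℝ)⁻¹ = 2 * Fintype.card A := by
    rw [radialEigenvalue, mul_inv_cancel₀ hq.ne', inv_inv]
    ring
  have hmid : radialEigenvalue A (Fintype.card A : ℝ)⁻¹ < 2 * Fintype.card A := by
    rw [radialEigenvalue, inv_inv, sub_one_mul, mul_inv_cancel_right₀ (by positivity)]
    linarith
  have hcont : ContinuousAt (radialEigenvalue A) (2 * Fintype.card A - 1 : ℝ)⁻¹ :=
    (continuousAt_const.mul continuousAt_id).add (continuousAt_inv₀ (inv_pos.2 hq).ne')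
  have hgt : ∀ᶠ ρ in 𝓝[>] (2 * Fintype.card A - 1 : ℝ)⁻¹,
      max r (radialEigenvalue A (Fintype.card A : ℝ)⁻¹) < radialEigenvalue A ρ :=
    nhdsWithin_le_nhds (hcont.eventually_const_lt ((max_lt hr hmid).trans_eq htop.symm))
  have hlt : (2 * Fintype.card A - 1 : ℝ)⁻¹ < (Fintype.card A : ℝ)⁻¹ :=
    inv_strictAnti₀ (by linarith) (by linarith)
  obtain ⟨ρ, hρ, hρq, hρk⟩ := (hgt.and (Ioo_mem_nhdsGT hlt)).exists
  rw [max_lt_iff] at hρ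
  exact ⟨ρ, (Fintype.card A : ℝ)⁻¹, hρq, hρk, inv_lt_one_of_one_lt₀ (by linarith), hρ.2, hρ.1⟩

/-- One direction of Grigorchuk's cogrowth criterion. -/
theorem growsSlowerThan_numReducedWords (hA : 2 ≤ Fintype.card A) {H : Subgroup (FreeGroup A)}
    (h : GrowsSlowerThan (numWords H) (2 * Fintype.card A)) :
    GrowsSlowerThan (numReducedWords H) (2 * Fintype.card A - 1) := by
  have : Nonempty A := Fintype.card_pos_iff.1 (by lia)
  have hk : (2 : ℝ) ≤ Fintype.card A := mod_cast hA
  obtain ⟨r, ⟨hr1, hrA⟩, C, hC⟩ := h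
  obtain ⟨ρ, ρ', hqρ, hρρ', hρ', hev, hrρ⟩ := exists_radii_of_lt hA hrA
  have hρ : 0 < ρ := (inv_pos.2 (by linarith)).trans hqρ
  refine ⟨ρ⁻¹, ⟨(one_lt_inv₀ hρ).2 (hρρ'.trans hρ'), inv_lt_of_inv_lt₀ (by linarith) hqρ⟩,
    C * (1 - r / radialEigenvalue A ρ)⁻¹, fun n => ?_⟩
  rw [inv_pow, ← div_eq_mul_inv, le_div_iff₀ (by positivity)]
  exact numReducedWords_mul_pow_le (by linarith) hC hρ hρρ'.le hρ'.le hev hrρ n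

end Cogrowth

/-! ### Densities -/

section FiniteIndex

variable {A : Type*} [Fintype A] {H : Subgroup (FreeGroup A)}

theorem one_lt_two_mul_card_sub_one (hA : 2 ≤ Fintype.card A) :
    (1 : ℝ) < 2 * Fintype.card A - 1 := by
  have : (2 : ℝ) ≤ Fintype.card A := mod_cast hA
  linarith

theorem one_lt_two_mul_card (hA : 2 ≤ Fintype.card A) : (1 : ℝ) < 2 * Fintype.card A := by
  linarith [one_lt_two_mul_card_sub_one hA]

theorem limsup_numReducedWords_pos (hA : 2 ≤ Fintype.card A) (hH : H.FiniteIndex) :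
    0 < limsup (fun n => (numReducedWords H n : ℝ) / (2 * Fintype.card A - 1) ^ n) atTop :=
  have : Nonempty A := Fintype.card_pos_iff.1 (by lia)
  limsup_div_pow_pos (by linarith [one_lt_two_mul_card_sub_one hA]) (fun _ => le_rfl)
    (numReducedWords_le H) (not_tendsto_numReducedWords_div hA hH)

theorem limsup_numReducedWordsLE_pos (hA : 2 ≤ Fintype.card A) (hH : H.FiniteIndex) :
    0 < limsup (fun n => (numReducedWordsLE H n : ℝ) / (2 * Fintype.card A - 1) ^ n) atTop :=
  have : Nonempty A := Fintype.card_pos_iff.1 (by lia)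
  have hq := one_lt_two_mul_card_sub_one hA
  limsup_div_pow_pos (by linarith) (numReducedWords_le_numReducedWordsLE H)
    (fun n => numReducedWordsLE_eq_sum H n ▸ sum_range_le_of_le_mul_pow hq (numReducedWords_le H) n)
    (not_tendsto_numReducedWords_div hA hH)

theorem limsup_numWords_pos (hA : 2 ≤ Fintype.card A) (hH : H.FiniteIndex) :
    0 < limsup (fun n => (numWords H n : ℝ) / (2 * Fintype.card A) ^ n) atTop :=
  have : Nonempty A := Fintype.card_pos_iff.1 (by lia)
  limsup_div_pow_pos (by linarith [one_lt_two_mul_card hA]) (fun _ => le_rfl)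
    (numWords_le H) (not_tendsto_numWords_div hA hH)

theorem limsup_numWordsLE_pos (hA : 2 ≤ Fintype.card A) (hH : H.FiniteIndex) :
    0 < limsup (fun n => (numWordsLE H n : ℝ) / (2 * Fintype.card A) ^ n) atTop :=
  have : Nonempty A := Fintype.card_pos_iff.1 (by lia)
  have hq := one_lt_two_mul_card hA
  limsup_div_pow_pos (by linarith) (numWords_le_numWordsLE H)
    (fun n => numWordsLE_eq_sum H n ▸ sum_range_le_of_le_mul_pow hq (numWords_le H) n)
    (not_tendsto_numWords_div hA hH)

end FiniteIndex

section InfiniteIndex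

variable {A : Type*} [Fintype A] {H : Subgroup (FreeGroup A)}

theorem tendsto_numReducedWordsLE_div (hA : 2 ≤ Fintype.card A) (hH : ¬ H.FiniteIndex) :
    Tendsto (fun n => (numReducedWordsLE H n : ℝ) / (2 * Fintype.card A - 1) ^ n) atTop (𝓝 0) := by
  simpa only [numReducedWordsLE_eq_sum] using tendsto_sum_range_div_pow
    (one_lt_two_mul_card_sub_one hA) (tendsto_numReducedWords_div hA hH)

theorem tendsto_numWordsLE_div (hA : 2 ≤ Fintype.card A) (hH : ¬ H.FiniteIndex) :
    Tendsto (fun n => (numWordsLE H n : ℝ) / (2 * Fintype.card A) ^ n) atTop (𝓝 0) := by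
  simpa only [numWordsLE_eq_sum] using tendsto_sum_range_div_pow
    (one_lt_two_mul_card hA) (tendsto_numWords_div hA hH)

theorem wordDensity_nonneg {X : Type*} (S : Set (List X)) (n : ℕ) : 0 ≤ wordDensity S n :=
  div_nonneg (Nat.cast_nonneg _) (Nat.cast_nonneg _)

theorem ballDensity_nonneg {A : Type*} [DecidableEq A] (S : Set (FreeGroup A)) (n : ℕ) :
    0 ≤ ballDensity S n :=
  div_nonneg (Nat.cast_nonneg _) (Nat.cast_nonneg _)

theorem tendsto_wordDensity (hA : 2 ≤ Fintype.card A) (hH : ¬ H.FiniteIndex) :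
    Tendsto (wordDensity (wordsRepresenting H)) atTop (𝓝 0) :=
  have : Nonempty A := Fintype.card_pos_iff.1 (by lia)
  squeeze_zero (wordDensity_nonneg _) (wordDensity_le H) (tendsto_numWordsLE_div hA hH)

theorem tendsto_ballDensity [DecidableEq A] (hA : 2 ≤ Fintype.card A) (hH : ¬ H.FiniteIndex) :
    Tendsto (ballDensity (H : Set (FreeGroup A))) atTop (𝓝 0) :=
  squeeze_zero (ballDensity_nonneg _) (ballDensity_le H hA) (tendsto_numReducedWordsLE_div hA hH)

end InfiniteIndex

section NonAmenable

variable {A : Type*} [Fintype A] {H : Subgroup (FreeGroup A)}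

theorem growsSlowerThan_numWords_of_not_isAmenable (hA : 2 ≤ Fintype.card A)
    (h : ¬ (CosetGraph.graph H).IsAmenable (2 * Fintype.card A) (CosetGraph.base H)) :
    GrowsSlowerThan (numWords H) (2 * Fintype.card A) := by
  have hle := CosetGraph.isRegular_graph.nonReducedCogrowthRate_le (by lia) (CosetGraph.base H)
  have hne : (CosetGraph.graph H).nonReducedCogrowthRate (CosetGraph.base H) ≠
      (2 * Fintype.card A : ℕ) := fun heq => h <| by
    rw [SerreGraph.IsAmenable, SerreGraph.spectralRadius, heq]
    exact ENNReal.div_self (Nat.cast_ne_zero.2 (by lia)) (ENNReal.natCast_ne_top _)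
  have hlt := hle.lt_of_ne hne
  simp only [SerreGraph.nonReducedCogrowthRate, CosetGraph.numClosedPaths_eq] at hlt
  exact_mod_cast GrowsSlowerThan.of_limsup_root_lt (by lia) hlt

theorem not_finiteIndex_of_growsSlowerThan (hA : 2 ≤ Fintype.card A)
    (h : GrowsSlowerThan (numWords H) (2 * Fintype.card A)) : ¬ H.FiniteIndex := fun hH =>
  not_tendsto_numWords_div hA hH h.tendsToZeroExpFast.2.1

theorem tendsToZeroExpFast_wordDensity [Nonempty A]
    (h : GrowsSlowerThan (numWordsLE H) (2 * Fintype.card A)) :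
    TendsToZeroExpFast (wordDensity (wordsRepresenting H)) :=
  h.tendsToZeroExpFast.mono (wordDensity_nonneg _) (wordDensity_le H)

theorem tendsToZeroExpFast_ballDensity [DecidableEq A] (hA : 2 ≤ Fintype.card A)
    (h : GrowsSlowerThan (numReducedWordsLE H) (2 * Fintype.card A - 1)) :
    TendsToZeroExpFast (ballDensity (H : Set (FreeGroup A))) :=
  h.tendsToZeroExpFast.mono (ballDensity_nonneg _) (ballDensity_le H hA)

end NonAmenable

theorem theorem6p3_general {A : Type*} [Fintype A] [DecidableEq A] (hA : 2 ≤ Fintype.card A)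
    (H : Subgroup (FreeGroup A)) :
    ((CosetGraph.graph H).IsRegular (2 * Fintype.card A) ∧
      (CosetGraph.graph H).cogrowthRate (CosetGraph.base H) ≤
        ((2 * Fintype.card A - 1 : ℕ) : ℝ≥0∞) ∧
      (CosetGraph.graph H).nonReducedCogrowthRate (CosetGraph.base H) ≤
        ((2 * Fintype.card A : ℕ) : ℝ≥0∞)) ∧
    (∀ n : ℕ, ((freeBall A n).ncard : ℝ) =
      1 + (Fintype.card A : ℝ) / (Fintype.card A - 1) * ((2 * Fintype.card A - 1) ^ n - 1)) ∧
    (¬ H.FiniteIndex →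
      Tendsto (fun n : ℕ => (numReducedWords H n : ℝ) / (2 * Fintype.card A - 1) ^ n) atTop (𝓝 0) ∧
      Tendsto (fun n : ℕ => (numReducedWordsLE H n : ℝ) / (2 * Fintype.card A - 1) ^ n)
        atTop (𝓝 0) ∧
      Tendsto (fun n : ℕ => (numWords H n : ℝ) / (2 * Fintype.card A) ^ n) atTop (𝓝 0) ∧
      Tendsto (fun n : ℕ => (numWordsLE H n : ℝ) / (2 * Fintype.card A) ^ n) atTop (𝓝 0) ∧
      Tendsto (wordDensity (wordsRepresenting H)) atTop (𝓝 0) ∧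
      Tendsto (ballDensity (H : Set (FreeGroup A))) atTop (𝓝 0)) ∧
    (¬ (CosetGraph.graph H).IsAmenable (2 * Fintype.card A) (CosetGraph.base H) →
      ¬ H.FiniteIndex ∧
      TendsToZeroExpFast (fun n : ℕ => (numReducedWords H n : ℝ) / (2 * Fintype.card A - 1) ^ n) ∧
      TendsToZeroExpFast (fun n : ℕ => (numReducedWordsLE H n : ℝ) / (2 * Fintype.card A - 1) ^ n) ∧
      TendsToZeroExpFast (fun n : ℕ => (numWords H n : ℝ) / (2 * Fintype.card A) ^ n) ∧
      TendsToZeroExpFast (fun n : ℕ => (numWordsLE H n : ℝ) / (2 * Fintype.card A) ^ n) ∧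
      TendsToZeroExpFast (wordDensity (wordsRepresenting H)) ∧
      TendsToZeroExpFast (ballDensity (H : Set (FreeGroup A)))) ∧
    (H.FiniteIndex →
      0 < limsup (fun n : ℕ => (numReducedWords H n : ℝ) / (2 * Fintype.card A - 1) ^ n) atTop ∧
      0 < limsup (fun n : ℕ => (numReducedWordsLE H n : ℝ) / (2 * Fintype.card A - 1) ^ n) atTop ∧
      0 < limsup (fun n : ℕ => (numWords H n : ℝ) / (2 * Fintype.card A) ^ n) atTop ∧
      0 < limsup (fun n : ℕ => (numWordsLE H n : ℝ) / (2 * Fintype.card A) ^ n) atTop) := by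
  have : Nonempty A := Fintype.card_pos_iff.1 (by lia)
  refine ⟨⟨CosetGraph.isRegular_graph,
      CosetGraph.isRegular_graph.cogrowthRate_le (by lia) _,
      CosetGraph.isRegular_graph.nonReducedCogrowthRate_le (by lia) _⟩,
    ncard_freeBall hA, fun hH => ?infinite, fun hH => ?nonAmenable, fun hH => ?finite⟩
  case infinite =>
    exact ⟨tendsto_numReducedWords_div hA hH, tendsto_numReducedWordsLE_div hA hH,
      tendsto_numWords_div hA hH, tendsto_numWordsLE_div hA hH,
      tendsto_wordDensity hA hH, tendsto_ballDensity hA hH⟩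
  case nonAmenable =>
    have hb := growsSlowerThan_numWords_of_not_isAmenable hA hH
    have ha := growsSlowerThan_numReducedWords hA hb
    have hz := growsSlowerThan_numWordsLE hb
    have hr := growsSlowerThan_numReducedWordsLE ha
    exact ⟨not_finiteIndex_of_growsSlowerThan hA hb,
      ha.tendsToZeroExpFast, hr.tendsToZeroExpFast, hb.tendsToZeroExpFast, hz.tendsToZeroExpFast,
      tendsToZeroExpFast_wordDensity hz, tendsToZeroExpFast_ballDensity hA hr⟩
  case finite =>
    exact ⟨limsup_numReducedWords_pos hA hH, limsup_numReducedWordsLE_pos hA hH,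
      limsup_numWords_pos hA hH, limsup_numWordsLE_pos hA hH⟩

theorem theorem6p3 (k : ℕ) (hk : 2 ≤ k) (H : Subgroup (FreeGroup (Fin k))) :
    -- the coset graph is regular of degree 2k, and the two cogrowth rates are bounded
    ((CosetGraph.graph H).IsRegular (2 * k) ∧
      (CosetGraph.graph H).cogrowthRate (CosetGraph.base H) ≤ ((2 * k - 1 : ℕ) : ℝ≥0∞) ∧
      (CosetGraph.graph H).nonReducedCogrowthRate (CosetGraph.base H) ≤ ((2 * k : ℕ) : ℝ≥0∞)) ∧
    -- the cardinality of the balls of the free group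
    (∀ n : ℕ, ((freeBall (Fin k) n).ncard : ℝ) =
      1 + (k : ℝ) / ((k : ℝ) - 1) * ((2 * (k : ℝ) - 1) ^ n - 1)) ∧
    -- infinite index
    (¬ H.FiniteIndex →
      Tendsto (fun n : ℕ => (numReducedWords H n : ℝ) / (2 * (k : ℝ) - 1) ^ n) atTop (𝓝 0) ∧
      Tendsto (fun n : ℕ => (numReducedWordsLE H n : ℝ) / (2 * (k : ℝ) - 1) ^ n) atTop (𝓝 0) ∧
      Tendsto (fun n : ℕ => (numWords H n : ℝ) / (2 * (k : ℝ)) ^ n) atTop (𝓝 0) ∧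
      Tendsto (fun n : ℕ => (numWordsLE H n : ℝ) / (2 * (k : ℝ)) ^ n) atTop (𝓝 0) ∧
      Tendsto (wordDensity (wordsRepresenting H)) atTop (𝓝 0) ∧
      Tendsto (ballDensity (H : Set (FreeGroup (Fin k)))) atTop (𝓝 0)) ∧
    -- non-amenable coset graph
    (¬ (CosetGraph.graph H).IsAmenable (2 * k) (CosetGraph.base H) →
      ¬ H.FiniteIndex ∧
      TendsToZeroExpFast (fun n : ℕ => (numReducedWords H n : ℝ) / (2 * (k : ℝ) - 1) ^ n) ∧
      TendsToZeroExpFast (fun n : ℕ => (numReducedWordsLE H n : ℝ) / (2 * (k : ℝ) - 1) ^ n) ∧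
      TendsToZeroExpFast (fun n : ℕ => (numWords H n : ℝ) / (2 * (k : ℝ)) ^ n) ∧
      TendsToZeroExpFast (fun n : ℕ => (numWordsLE H n : ℝ) / (2 * (k : ℝ)) ^ n) ∧
      TendsToZeroExpFast (wordDensity (wordsRepresenting H)) ∧
      TendsToZeroExpFast (ballDensity (H : Set (FreeGroup (Fin k))))) ∧
    -- finite index
    (H.FiniteIndex →
      0 < limsup (fun n : ℕ => (numReducedWords H n : ℝ) / (2 * (k : ℝ) - 1) ^ n) atTop ∧
      0 < limsup (fun n : ℕ => (numReducedWordsLE H n : ℝ) / (2 * (k : ℝ) - 1) ^ n) atTop ∧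
      0 < limsup (fun n : ℕ => (numWords H n : ℝ) / (2 * (k : ℝ)) ^ n) atTop ∧
      0 < limsup (fun n : ℕ => (numWordsLE H n : ℝ) / (2 * (k : ℝ)) ^ n) atTop) := by
  simpa only [Fintype.card_fin] using theorem6p3_general (by rwa [Fintype.card_fin]) H
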